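/- Let $w:\mathbb R\to[0,\infty)$ be a $C^\infty$ function with $\operatorname{supp}w\subset[1/2,2]$ and $w(t)=1-w(t/2)$ for $t\in[1,2]$. With the Fourier transform $(\mathcal F g)(t)=\int_{\mathbb R^2}g(x)e^{-i(x,t)}\,dx$, define $W_n$ ($n\ge1$) and $W^{[0]}$ on $\mathbb R^2$ by $(\mathcal F W_n)(t)=w(\|t\|_2/2^n)$ and $\mathcal F W^{[0]}=1-\sum_{n\ge1}\mathcal F W_n$. The inhomogeneous Besov space $B^1_{\infty,1}(\mathbb R^2)$ consists of the tempered distributions $f$ on $\mathbb R^2$ with $$\|f\|_{B^1_{\infty,1}}=\|f*W^{[0]}\|_{L^\infty}+\sum_{n\ge1}2^n\|f*W_n\|_{L^\infty}<\infty .$$ Let $\mathscr B^\infty$ be the space of bounded Borel functions on $\mathbb R$. The Haagerup tensor product $\mathscr B^\infty\otimes_{\rm h}\mathscr B^\infty$ consists of the functions $\Phi$ on $\mathbb R\times\mathbb R$ that admit a representation $\Phi(s,t)=\sum_n\varphi_n(s)\psi_n(t)$, for all $s,t\in\mathbb R$, with sequences $\varphi_n,\psi_n\in\mathscr B^\infty$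 such that $\sup_s\sum_n|\varphi_n(s)|^2<\infty$ and $\sup_t\sum_n|\psi_n(t)|^2<\infty$; its norm $\|\Phi\|_{\mathscr B^\infty\otimes_{\rm h}\mathscr B^\infty}$ is the infimum of $\big(\sup_s\sum_n|\varphi_n(s)|^2\cdot\sup_t\sum_n|\psi_n(t)|^2\big)^{1/2}$ over all such representations. **Theorem.** There is an absolute constant $C$ such that the following holds for every $w$ as above and every $f\in B^1_{\infty,1}(\mathbb R^2)$. The distribution $f$ is induced by a unique bounded continuous function on $\mathbb R^2$, again denoted by $f$, and the function $f_\sharp(s,t)=(1-it)^{-1}f(s,t)$ belongs to $\mathscr B^\infty\otimes_{\rm h}\mathscr B^\infty$ with $$\|f_\sharp\|_{\mathscr B^\infty\otimes_{\rm h}\mathscr B^\infty}\le C\,\|f\|_{B^1_{\infty,1}} .$$ Consequently $f(A,B)$ is well defined on $D(B)$ for arbitrary (not necessarily bounded, not necessarily commuting) self-adjoint operators $A$ and $B$ on a complex Hilbert space, with spectral measures $E_A$ and $E_B$: there is a unique operator $f(A,B)$ with domain $D(B)$ such that $$f(A,B)=f_\sharp(A,B)(I-iB),\qquad f_\sharp(A,B)=\iint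 f_\sharp(s,t)\,dE_A(s)\,dE_B(t),$$ where $f_\sharp(A,B)$ is the bounded operator to which, for every representation $f_\sharp(s,t)=\sum_n\varphi_n(s)\psi_n(t)$ as above, the series $\sum_n\left(\int\varphi_n\,dE_A\right)\left(\int\psi_n\,dE_B\right)$ converges in the weak operator topology. -/

import Mathlib

open MeasureTheory Set
open scoped ENNReal NNReal SchwartzMap BoundedContinuousFunction

noncomputable section

namespace PairFunctions

/-! ### The inhomogeneous Besov space on the plane -/

/-- The plane with its Euclidean norm. -/
abbrev Plane : Type := EuclideanSpace ℝ (Fin 2)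

/-- The smooth bump functions `w` on the half-line that generate the dyadic resolution of unity:
`w ≥ 0`, `supp w ⊆ [1/2, 2]` and `w t = 1 - w (t / 2)` for `t ∈ [1, 2]`. -/
structure IsDyadicBump (w : ℝ → ℝ) : Prop where
  smooth : ContDiff ℝ (⊤ : ℕ∞) w
  nonneg : ∀ t, 0 ≤ w t
  support_subset : tsupport w ⊆ Icc (1 / 2) 2
  eq_one_sub : ∀ t ∈ Icc (1 : ℝ) 2, w t = 1 - w (t / 2)

/-- The Fourier transform of `W_n`, i.e. `t ↦ w (‖t‖ / 2 ^ n)`, as a function of the angular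
frequency `t` (the variable of the Fourier transform with kernel `exp (-i (x, t))`). -/
def blockSymbol (w : ℝ → ℝ) (n : ℕ) (t : Plane) : ℝ := w (‖t‖ / 2 ^ n)

/-- The Fourier transform of `W^{[0]}`, i.e. `1 - ∑_{n ≥ 1} w (‖t‖ / 2 ^ n)`, again in the angular
frequency `t`. At every `t` at most two terms of the series are nonzero. -/
def lowSymbol (w : ℝ → ℝ) (t : Plane) : ℝ := 1 - ∑' n : ℕ, blockSymbol w (n + 1) t

/-- The convolution `T * W` of a tempered distribution `T` with the function `W` whose Fourier
transform (with kernel `exp (-i (x, t))`) is `m`: the tempered distribution whose Fourier transform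
is the one of `T` multiplied by `m`. Mathlib's Fourier transform has the kernel
`exp (-2 π i (x, ξ))`, so that `t = 2 π ξ`. -/
def convWithSymbol (m : Plane → ℝ) (T : 𝓢'(Plane, ℂ)) : 𝓢'(Plane, ℂ) :=
  TemperedDistribution.fourierMultiplierCLM ℂ
    (fun ξ : Plane => ((m ((2 * Real.pi) • ξ) : ℝ) : ℂ)) T

/-- The `L^∞` norm of a tempered distribution: the norm of the element of `L^∞` that induces it,
and `∞` if there is none. -/
def linftyNorm (T : 𝓢'(Plane, ℂ)) : ℝ≥0∞ :=
  ⨅ (g : Lp ℂ ∞ (volume : Measure Plane)) (_ : Lp.toTemperedDistribution g = T), ‖g‖ₑ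

/-- The norm `‖T * W^{[0]}‖_∞ + ∑_{n ≥ 1} 2 ^ n ‖T * W_n‖_∞` of the inhomogeneous Besov space,
with the value `∞` off the space. -/
def besovNorm (w : ℝ → ℝ) (T : 𝓢'(Plane, ℂ)) : ℝ≥0∞ :=
  linftyNorm (convWithSymbol (lowSymbol w) T) +
    ∑' n : ℕ, 2 ^ (n + 1) * linftyNorm (convWithSymbol (blockSymbol w (n + 1)) T)

/-- Membership of a tempered distribution in the inhomogeneous Besov space `B^1_{∞,1}(ℝ²)`. -/
def MemBesov (w : ℝ → ℝ) (T : 𝓢'(Plane, ℂ)) : Prop := besovNorm w T < ∞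

/-- The distribution `T` is (integration against) the bounded continuous function `f`. -/
def IsInducedBy (T : 𝓢'(Plane, ℂ)) (f : Plane →ᵇ ℂ) : Prop :=
  ∀ φ : 𝓢(Plane, ℂ), T φ = ∫ x, φ x * f x

/-! ### The Haagerup tensor product of two copies of the bounded Borel functions -/

/-- `Φ (s, t) = ∑_n φ_n (s) ψ_n (t)` for all real `s` and `t`, with Borel functions `φ_n`, `ψ_n`
such that `∑_n |φ_n|²` and `∑_n |ψ_n|²` are bounded (in particular every `φ_n`, `ψ_n` is bounded).
-/
structure IsHaagerupRep (Φ : ℝ → ℝ → ℂ) (φ ψ : ℕ → ℝ → ℂ) : Prop where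
  measurable_left : ∀ n, Measurable (φ n)
  measurable_right : ∀ n, Measurable (ψ n)
  bounded_left : (⨆ s, ∑' n, ‖φ n s‖ₑ ^ 2) < ∞
  bounded_right : (⨆ t, ∑' n, ‖ψ n t‖ₑ ^ 2) < ∞
  hasSum : ∀ s t, HasSum (fun n => φ n s * ψ n t) (Φ s t)

/-- Membership in the Haagerup tensor product of the bounded Borel functions. -/
def MemHaagerup (Φ : ℝ → ℝ → ℂ) : Prop := ∃ φ ψ, IsHaagerupRep Φ φ ψ

/-- The Haagerup norm: the infimum over all representations of
`(sup_s ∑_n |φ_n(s)|² · sup_t ∑_n |ψ_n(t)|²)^{1/2}`, and `∞` if there is no representation. -/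
def haagerupNorm (Φ : ℝ → ℝ → ℂ) : ℝ≥0∞ :=
  ⨅ (φ : ℕ → ℝ → ℂ) (ψ : ℕ → ℝ → ℂ) (_ : IsHaagerupRep Φ φ ψ),
    ((⨆ s, ∑' n, ‖φ n s‖ₑ ^ 2) * (⨆ t, ∑' n, ‖ψ n t‖ₑ ^ 2)) ^ (1 / 2 : ℝ)

/-- `f_♯ (s, t) = (1 - i t)⁻¹ f (s, t)`. -/
def sharp (f : Plane → ℂ) (s t : ℝ) : ℂ := (1 - Complex.I * t)⁻¹ * f !₂[s, t]

/-! ### Spectral measures and double operator integrals -/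

/-- A (projection-valued, countably additive) spectral measure on the Borel sets of the line. -/
structure SpectralMeasure (H : Type*) [NormedAddCommGroup H] [InnerProductSpace ℂ H]
    [CompleteSpace H] where
  /-- The spectral projection of a Borel set (no condition for other sets). -/
  proj : Set ℝ → H →L[ℂ] H
  isStarProjection : ∀ S, MeasurableSet S → IsStarProjection (proj S)
  proj_univ : proj univ = 1
  hasSum_iUnion : ∀ S : ℕ → Set ℝ, (∀ i, MeasurableSet (S i)) →
    Pairwise (Function.onFun Disjoint S) →
    ∀ x : H, HasSum (fun i => proj (S i) x) (proj (⋃ i, S i) x)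

variable {H : Type*} [NormedAddCommGroup H] [InnerProductSpace ℂ H] [CompleteSpace H]

namespace SpectralMeasure

lemma re_inner_proj_nonneg (E : SpectralMeasure H) (x : H) {S : Set ℝ} (hS : MeasurableSet S) :
    0 ≤ (inner ℂ x (E.proj S x)).re := by
  have h := E.isStarProjection S hS
  have h1 : E.proj S x = E.proj S (E.proj S x) := by
    conv_lhs => rw [← h.isIdempotentElem]
    rfl
  have h2 : inner ℂ x (E.proj S (E.proj S x)) = inner ℂ (E.proj S x) (E.proj S x) :=
    ((ContinuousLinearMap.isSelfAdjoint_iff_isSymmetric.mp h.isSelfAdjoint) x (E.proj S x)).symm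
  rw [h1, h2]
  exact inner_self_nonneg (𝕜 := ℂ)

lemma proj_empty_apply (E : SpectralMeasure H) (x : H) : E.proj ∅ x = 0 := by
  have h := (E.hasSum_iUnion (fun _ => ∅) (fun _ => MeasurableSet.empty)
    (fun i j _ => disjoint_bot_left) x).summable
  exact tendsto_nhds_unique tendsto_const_nhds h.tendsto_atTop_zero

/-- The finite positive measure `S ↦ (E(S) x, x)`. -/
def scalar (E : SpectralMeasure H) (x : H) : Measure ℝ :=
  Measure.ofMeasurable (fun S _ => ENNReal.ofReal (inner ℂ x (E.proj S x)).re)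
    (by simp [proj_empty_apply]) (by
      intro S hS hd
      have h := (E.hasSum_iUnion S hS hd x).mapL (innerSL ℂ x)
      have h' : HasSum (fun i => (inner ℂ x (E.proj (S i) x)).re)
          (inner ℂ x (E.proj (⋃ i, S i) x)).re := by
        simpa using h.mapL Complex.reCLM
      rw [← h'.tsum_eq,
        ENNReal.ofReal_tsum_of_nonneg (fun i => E.re_inner_proj_nonneg x (hS i)) h'.summable])

/-- The bounded operator `∫ φ dE` for a bounded Borel function `φ`: the unique bounded operator `T`
with `(T x, x) = ∫ φ(t) d(E(t) x, x)` for all vectors `x`. (It exists for all such `φ`; the value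
`0` is for other functions.) -/
def integral (E : SpectralMeasure H) (φ : ℝ → ℂ) : H →L[ℂ] H :=
  open Classical in
  if h : ∃ T : H →L[ℂ] H, ∀ x, inner ℂ x (T x) = ∫ t, φ t ∂(E.scalar x) then h.choose else 0

/-- `E` is the spectral measure of the (possibly unbounded) operator `A`, i.e. `A = ∫ t dE(t)`:
the domain of `A` consists of the vectors `x` with `∫ t² d(E(t) x, x) < ∞`, and
`(A x, x) = ∫ t d(E(t) x, x)` for these `x`. -/
structure IsSpectralMeasureOf (E : SpectralMeasure H) (A : H →ₗ.[ℂ] H) : Prop where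
  mem_domain_iff : ∀ x, x ∈ A.domain ↔ Integrable (fun t : ℝ => t ^ 2) (E.scalar x)
  inner_apply : ∀ x : A.domain, inner ℂ (x : H) (A x) = ∫ t : ℝ, (t : ℂ) ∂(E.scalar (x : H))

end SpectralMeasure

/-- `S` is the double operator integral `∬ Φ(s,t) dE₁(s) Q dE₂(t)`: the function `Φ` is in the
Haagerup tensor product of the bounded Borel functions and, for every representation
`Φ (s, t) = ∑_n φ_n (s) ψ_n (t)`, the series `∑_n (∫ φ_n dE₁) Q (∫ ψ_n dE₂)` converges to `S` in
the weak operator topology. -/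
structure IsDoubleOperatorIntegral (E₁ E₂ : SpectralMeasure H) (Φ : ℝ → ℝ → ℂ)
    (Q S : H →L[ℂ] H) : Prop where
  memHaagerup : MemHaagerup Φ
  hasSum : ∀ φ ψ, IsHaagerupRep Φ φ ψ → ∀ x y : H,
    HasSum (fun n => inner ℂ y (E₁.integral (φ n) (Q (E₂.integral (ψ n) x)))) (inner ℂ y (S x))

/-- `F` is the operator `f(A, B) = f_♯(A, B) (I - i B)` with domain `D(B)`, where
`f_♯(A, B) = ∬ f_♯(s,t) dE_A(s) dE_B(t)` and `E_A`, `E_B` are the spectral measures of `A`, `B`. -/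
def IsFunctionOfPair (EA EB : SpectralMeasure H) (B : H →ₗ.[ℂ] H) (f : Plane → ℂ)
    (F : H →ₗ.[ℂ] H) : Prop :=
  F.domain = B.domain ∧
    ∃ S : H →L[ℂ] H, IsDoubleOperatorIntegral EA EB (sharp f) 1 S ∧
      ∀ (x : F.domain) (y : B.domain), (x : H) = y → F x = S (y - Complex.I • B y)

end PairFunctions

end

open PairFunctions

noncomputable section

namespace PairFunctions

open Filter Topology

namespace SpectralMeasure

/-! ### Integrals of bounded Borel functions against a spectral measure. -/

section Calculus

/-! Analytic part. Dividing by `1 - it` makes a bounded function of `t` square integrable, and this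
allows a factorization through `L²(ℝ)`. Split `f` into dyadic blocks. In the variable of Mathlib's
Fourier transform the `n`-th block has spectrum in `‖ξ‖ ≤ 2 ^ n`, so it is unchanged by averaging
along a coordinate axis at scale `h = 2⁻ⁿ` against `K = 𝓕 k`, where `k` is one fixed Schwartz cutoff
equal to one on `[-1, 1]`. If `g` is a bounded function inducing the block, averaging in `t` and
substituting `v = t + hu` give `f_n(s,t) / (1 - it) = ∫ [g(s,v) / (1 - iv)] · [(1 - iv) / (1 - it) ·
h⁻¹ K((v - t) / h)] dv`. The first bracket is in `L²(dv)` uniformly in `s` because `g` is bounded;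
the second uniformly in `t` because `K` decays quadratically and `1 + v² ≤ 2 (1 + t²)(1 + u²)`.
Expanding both in an orthonormal basis of `L²` turns the integral into a Haagerup series
(`HasRepLE.of_integral`, `hasRepLE_sharp_lineAverage`) whose two square sums are `O(2ⁿ ‖f_n‖_∞)`.
Concatenating the series over `n` adds these bounds (`HasRepLE.hasSum`), which produces the Besov
norm. Since `k` is chosen before `w`, the constant is absolute.

Operator part. The identity `‖(∫ φ dE) x‖² = ∫ |φ|² d(E x, x)` makes the vectors `(∫ ψ_n dE_B) x`
square summable. The bound for the row of operators `∫ φ_n dE_A` is dual to this, so the series of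
the double operator integral converges even strongly. Its sum does not depend on the representation
because a representation of zero gives zero (`hasSum_integral_integral_zero`). -/

lemma ext_of_inner {H : Type*} [NormedAddCommGroup H] [InnerProductSpace ℂ H]
    {S T : H →L[ℂ] H} (h : ∀ x, inner ℂ x (S x) = inner ℂ x (T x)) : S = T := by
  have h1 := (ext_inner_map (S : H →ₗ[ℂ] H) (T : H →ₗ[ℂ] H)).1 fun x => by
    have := congrArg (starRingEnd ℂ) (h x)
    simpa using this
  ext x
  exact LinearMap.congr_fun h1 x

variable {H : Type*} [NormedAddCommGroup H] [InnerProductSpace ℂ H] [CompleteSpace H]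
  (E : SpectralMeasure H)

lemma inner_proj_proj {S : Set ℝ} (hS : MeasurableSet S) (x y : H) :
    inner ℂ (E.proj S x) (E.proj S y) = inner ℂ x (E.proj S y) := by
  have h := E.isStarProjection S hS
  have h1 : E.proj S (E.proj S y) = E.proj S y := by
    conv_rhs => rw [← h.isIdempotentElem]
    rfl
  have h2 := (ContinuousLinearMap.isSelfAdjoint_iff_isSymmetric.mp h.isSelfAdjoint) x (E.proj S y)
  simp only [ContinuousLinearMap.coe_coe] at h2
  rw [h2, h1]

lemma inner_proj_self {S : Set ℝ} (hS : MeasurableSet S) (x : H) :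
    inner ℂ x (E.proj S x) = (((‖E.proj S x‖ ^ 2 : ℝ)) : ℂ) := by
  rw [← E.inner_proj_proj hS, inner_self_eq_norm_sq_to_K]
  push_cast
  rfl

lemma scalar_apply {S : Set ℝ} (hS : MeasurableSet S) (x : H) :
    E.scalar x S = ENNReal.ofReal (‖E.proj S x‖ ^ 2) := by
  rw [scalar, Measure.ofMeasurable_apply _ hS, E.inner_proj_self hS, Complex.ofReal_re]

lemma scalar_real {S : Set ℝ} (hS : MeasurableSet S) (x : H) :
    (E.scalar x).real S = ‖E.proj S x‖ ^ 2 := by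
  rw [measureReal_def, E.scalar_apply hS, ENNReal.toReal_ofReal (by positivity)]

instance (x : H) : IsFiniteMeasure (E.scalar x) :=
  ⟨by rw [E.scalar_apply MeasurableSet.univ]; exact ENNReal.ofReal_lt_top⟩

lemma scalar_real_univ (x : H) : (E.scalar x).real univ = ‖x‖ ^ 2 := by
  rw [E.scalar_real MeasurableSet.univ, E.proj_univ]; rfl

lemma scalar_union_real {S S' : Set ℝ} (hS' : MeasurableSet S')
    (hd : Disjoint S S') (x : H) :
    (E.scalar x).real (S ∪ S') = (E.scalar x).real S + (E.scalar x).real S' :=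
  measureReal_union hd hS'

lemma norm_proj_le {S : Set ℝ} (hS : MeasurableSet S) (x : H) : ‖E.proj S x‖ ≤ ‖x‖ := by
  have := measureReal_mono (μ := E.scalar x) (subset_univ S)
  rw [scalar_real_univ, E.scalar_real hS] at this
  exact abs_le_of_sq_le_sq' this (norm_nonneg _) |>.2

/-- Multiplicativity follows from additivity: for `y = E(S')x`, additivity gives `‖E(S ∪ S')y‖² =
‖E(S)y‖² + ‖y‖²`, while the left side is at most `‖y‖²`. -/
lemma proj_proj_of_disjoint {S S' : Set ℝ} (hS : MeasurableSet S) (hS' : MeasurableSet S')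
    (hd : Disjoint S S') (x : H) : E.proj S (E.proj S' x) = 0 := by
  have h := E.scalar_union_real hS' hd (E.proj S' x)
  have h1 : E.proj S' (E.proj S' x) = E.proj S' x := by
    conv_rhs => rw [← (E.isStarProjection S' hS').isIdempotentElem]
    rfl
  rw [E.scalar_real hS, E.scalar_real hS', E.scalar_real (hS.union hS'), h1] at h
  have h2 := E.norm_proj_le (hS.union hS') (E.proj S' x)
  have h3 : ‖E.proj (S ∪ S') (E.proj S' x)‖ ^ 2 ≤ ‖E.proj S' x‖ ^ 2 := by gcongr
  have h4 : ‖E.proj S (E.proj S' x)‖ ^ 2 ≤ 0 := by linarith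
  simpa using le_antisymm h4 (by positivity)

lemma inner_proj_of_disjoint {S S' : Set ℝ} (hS : MeasurableSet S) (hS' : MeasurableSet S')
    (hd : Disjoint S S') (x y : H) : inner ℂ (E.proj S x) (E.proj S' y) = 0 := by
  have h2 := (ContinuousLinearMap.isSelfAdjoint_iff_isSymmetric.mp
    (E.isStarProjection S hS).isSelfAdjoint) x (E.proj S' y)
  simp only [ContinuousLinearMap.coe_coe] at h2
  rw [h2, E.proj_proj_of_disjoint hS hS' hd, inner_zero_right]

/-- The operator `T` is the integral of `φ` against the spectral measure `E`. -/
structure IsIntegral (φ : ℝ → ℂ) (T : H →L[ℂ] H) : Prop where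
  inner_apply : ∀ x, inner ℂ x (T x) = ∫ t, φ t ∂(E.scalar x)
  norm_sq : ∀ x, ‖T x‖ ^ 2 = ∫ t, ‖φ t‖ ^ 2 ∂(E.scalar x)

lemma exists_isIntegral_simpleFunc (φ : SimpleFunc ℝ ℂ) : ∃ T, E.IsIntegral φ T := by
  refine ⟨∑ c ∈ φ.range, c • E.proj (φ ⁻¹' {c}), fun x => ?_, fun x => ?_⟩
  · rw [SimpleFunc.integral_eq_sum _ (φ.integrable_of_isFiniteMeasure)]
    simp only [_root_.sum_apply, _root_.smul_apply, inner_sum]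
    refine Finset.sum_congr rfl fun c _ => ?_
    rw [inner_smul_right, E.inner_proj_self (φ.measurableSet_preimage _),
      E.scalar_real (φ.measurableSet_preimage _), Complex.real_smul, mul_comm]
  · have h1 : ∫ t, ‖φ t‖ ^ 2 ∂(E.scalar x) =
        ∑ c ∈ φ.range, (E.scalar x).real (φ ⁻¹' {c}) • ‖c‖ ^ 2 := by
      have := SimpleFunc.integral_eq_integral (φ.map fun c => ‖c‖ ^ 2)
        (SimpleFunc.integrable_of_isFiniteMeasure (μ := E.scalar x) _)
      rw [← SimpleFunc.map_integral φ (fun c => ‖c‖ ^ 2) φ.integrable_of_isFiniteMeasure (by simp),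
        this]
      rfl
    rw [h1]
    have h2 : ((‖(∑ c ∈ φ.range, c • E.proj (φ ⁻¹' {c})) x‖ ^ 2 : ℝ) : ℂ) =
        ((∑ c ∈ φ.range, (E.scalar x).real (φ ⁻¹' {c}) • ‖c‖ ^ 2 : ℝ) : ℂ) := by
      have h3 := inner_self_eq_norm_sq_to_K (𝕜 := ℂ) ((∑ c ∈ φ.range, c • E.proj (φ ⁻¹' {c})) x)
      simp only [Complex.coe_algebraMap] at h3
      rw [Complex.ofReal_pow, ← h3, Complex.ofReal_sum]
      simp only [_root_.sum_apply, _root_.smul_apply, inner_sum,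
        sum_inner]
      refine Finset.sum_congr rfl fun c hc => ?_
      rw [Finset.sum_eq_single c]
      · rw [inner_smul_left, inner_smul_right, E.inner_proj_proj (φ.measurableSet_preimage _),
          E.inner_proj_self (φ.measurableSet_preimage _), E.scalar_real (φ.measurableSet_preimage _),
          ← mul_assoc, Complex.conj_mul',
          smul_eq_mul]
        push_cast
        ring
      · intro c' _ hc'
        rw [inner_smul_left, inner_smul_right, E.inner_proj_of_disjoint
          (φ.measurableSet_preimage _) (φ.measurableSet_preimage _), mul_zero, mul_zero]
        refine disjoint_left.2 fun t ht ht' => hc' ?_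
        simp only [mem_preimage, mem_singleton_iff] at ht ht'
        exact ht.symm.trans ht'
      · exact fun h => absurd hc h
    exact_mod_cast h2

variable {E}

lemma integrable_of_bound {φ : ℝ → ℂ} (hφ : Measurable φ) {C : ℝ} (hC : ∀ t, ‖φ t‖ ≤ C) (x : H) :
    Integrable φ (E.scalar x) :=
  Integrable.of_bound hφ.aestronglyMeasurable C (ae_of_all _ hC)

/-- Take uniformly bounded simple approximations. The `L²` isometry for their differences makes the
operators strongly Cauchy by dominated convergence, and both defining identities pass to the limit.
-/
lemma exists_isIntegral {φ : ℝ → ℂ} (hφ : Measurable φ) {C : ℝ} (hC : ∀ t, ‖φ t‖ ≤ C) :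
    ∃ T, E.IsIntegral φ T := by
  have hC0 : 0 ≤ C := (norm_nonneg _).trans (hC 0)
  have hs := hφ.stronglyMeasurable
  set f := hs.approxBounded C with hf
  have hb : ∀ n t, ‖f n t‖ ≤ C := fun n t => hs.norm_approxBounded_le hC0 n t
  have hl : ∀ t, Tendsto (fun n => f n t) atTop (𝓝 (φ t)) := fun t =>
    hs.tendsto_approxBounded_of_norm_le (hC t)
  choose T hT using fun n => E.exists_isIntegral_simpleFunc (f n)
  have hdiff : ∀ n m x, ‖T n x - T m x‖ ^ 2 = ∫ t, ‖f n t - f m t‖ ^ 2 ∂(E.scalar x) := by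
    intro n m x
    obtain ⟨R, hR⟩ := E.exists_isIntegral_simpleFunc (f n - f m)
    have : R = T n - T m := ext_of_inner fun y => by
      rw [hR.inner_apply, _root_.sub_apply, inner_sub_right, (hT n).inner_apply,
        (hT m).inner_apply, ← integral_sub (SimpleFunc.integrable_of_isFiniteMeasure _)
          (SimpleFunc.integrable_of_isFiniteMeasure _)]
      rfl
    have h2 := hR.norm_sq x
    rw [this] at h2
    exact h2
  have hcau : ∀ x, ∃ y, Tendsto (fun n => T n x) atTop (𝓝 y) := by
    intro x
    refine cauchySeq_tendsto_of_complete (cauchySeq_iff_tendsto_dist_atTop_0.2 ?_)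
    have h0 : Tendsto (fun p : ℕ × ℕ => ∫ t, ‖f p.1 t - f p.2 t‖ ^ 2 ∂(E.scalar x)) atTop
        (𝓝 (∫ t, (0 : ℝ) ∂(E.scalar x))) := by
      refine tendsto_integral_filter_of_dominated_convergence (fun _ => (2 * C) ^ 2) ?_ ?_
        (integrable_const _) ?_
      · exact Eventually.of_forall fun p => (((f p.1).measurable.sub
          (f p.2).measurable).norm.pow_const 2).aestronglyMeasurable
      · refine Eventually.of_forall fun p => ae_of_all _ fun t => ?_
        rw [Real.norm_of_nonneg (by positivity)]
        gcongr
        exact (norm_sub_le _ _).trans (by linarith [hb p.1 t, hb p.2 t])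
      · refine ae_of_all _ fun t => ?_
        have h1 : Tendsto (fun p : ℕ × ℕ => f p.1 t) atTop (𝓝 (φ t)) := by
          rw [← prod_atTop_atTop_eq]; exact (hl t).comp tendsto_fst
        have h2 : Tendsto (fun p : ℕ × ℕ => f p.2 t) atTop (𝓝 (φ t)) := by
          rw [← prod_atTop_atTop_eq]; exact (hl t).comp tendsto_snd
        simpa using ((h1.sub h2).norm.pow 2)
    simp only [← hdiff, integral_zero] at h0
    have h3 := h0.sqrt
    simpa [dist_eq_norm, Real.sqrt_sq] using h3
  choose g hg using hcau
  have hgl : Tendsto (fun n x => T n x) atTop (𝓝 g) := tendsto_pi_nhds.2 hg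
  refine ⟨continuousLinearMapOfTendsto T hgl, fun x => ?_, fun x => ?_⟩
  · have h1 : Tendsto (fun n => inner ℂ x (T n x)) atTop (𝓝 (inner ℂ x (g x))) :=
      tendsto_const_nhds.inner (hg x)
    have h2 : Tendsto (fun n => ∫ t, f n t ∂(E.scalar x)) atTop (𝓝 (∫ t, φ t ∂(E.scalar x))) :=
      tendsto_integral_of_dominated_convergence (fun _ => C)
        (fun n => (f n).measurable.aestronglyMeasurable) (integrable_const _)
        (fun n => ae_of_all _ (hb n)) (ae_of_all _ hl)
    simp only [(hT _).inner_apply] at h1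
    exact tendsto_nhds_unique h1 h2
  · have h1 : Tendsto (fun n => ‖T n x‖ ^ 2) atTop (𝓝 (‖g x‖ ^ 2)) := (hg x).norm.pow 2
    have h2 : Tendsto (fun n => ∫ t, ‖f n t‖ ^ 2 ∂(E.scalar x)) atTop
        (𝓝 (∫ t, ‖φ t‖ ^ 2 ∂(E.scalar x))) := by
      refine tendsto_integral_of_dominated_convergence (fun _ => C ^ 2)
        (fun n => ((f n).measurable.norm.pow_const 2).aestronglyMeasurable) (integrable_const _)
        (fun n => ae_of_all _ fun t => ?_) (ae_of_all _ fun t => (hl t).norm.pow 2)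
      rw [Real.norm_of_nonneg (by positivity)]
      gcongr
      exact hb n t
    simp only [(hT _).norm_sq] at h1
    exact tendsto_nhds_unique h1 h2

lemma isIntegral_integral {φ : ℝ → ℂ} (hφ : Measurable φ) {C : ℝ} (hC : ∀ t, ‖φ t‖ ≤ C) :
    E.IsIntegral φ (E.integral φ) := by
  obtain ⟨T, hT⟩ := exists_isIntegral (E := E) hφ hC
  have h : ∃ T : H →L[ℂ] H, ∀ x, inner ℂ x (T x) = ∫ t, φ t ∂(E.scalar x) := ⟨T, hT.inner_apply⟩
  have h1 : E.integral φ = T := ext_of_inner fun x => by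
    rw [integral, dif_pos h, h.choose_spec x, hT.inner_apply]
  rwa [h1]

lemma IsIntegral.eq_integral {φ : ℝ → ℂ} {S T : H →L[ℂ] H} (hS : E.IsIntegral φ S)
    (hT : ∀ x, inner ℂ x (T x) = ∫ t, φ t ∂(E.scalar x)) : S = T :=
  ext_of_inner fun x => by rw [hS.inner_apply, hT]

lemma integral_add {φ ψ : ℝ → ℂ} (hφ : Measurable φ) (hψ : Measurable ψ) {C D : ℝ}
    (hC : ∀ t, ‖φ t‖ ≤ C) (hD : ∀ t, ‖ψ t‖ ≤ D) :
    E.integral (fun t => φ t + ψ t) = E.integral φ + E.integral ψ := by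
  refine (isIntegral_integral (hφ.add hψ) (C := C + D) fun t =>
    norm_add_le_of_le (hC t) (hD t)).eq_integral fun x => ?_
  rw [_root_.add_apply, inner_add_right, (isIntegral_integral hφ hC).inner_apply,
    (isIntegral_integral hψ hD).inner_apply]
  exact (MeasureTheory.integral_add (integrable_of_bound hφ hC x)
    (integrable_of_bound hψ hD x)).symm

lemma integral_const_mul {φ : ℝ → ℂ} (hφ : Measurable φ) {C : ℝ} (hC : ∀ t, ‖φ t‖ ≤ C) (c : ℂ) :
    E.integral (fun t => c * φ t) = c • E.integral φ := by
  refine (isIntegral_integral (hφ.const_mul c) (C := ‖c‖ * C) fun t => ?_).eq_integral fun x => ?_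
  · rw [norm_mul]
    exact mul_le_mul_of_nonneg_left (hC t) (norm_nonneg _)
  · rw [_root_.smul_apply, inner_smul_right,
      (isIntegral_integral hφ hC).inner_apply]
    exact (MeasureTheory.integral_const_mul c φ).symm

lemma integral_zero : E.integral (fun _ => (0 : ℂ)) = 0 :=
  (isIntegral_integral measurable_const (C := 0) (by simp)).eq_integral (by simp)

lemma integral_sub {φ ψ : ℝ → ℂ} (hφ : Measurable φ) (hψ : Measurable ψ) {C D : ℝ}
    (hC : ∀ t, ‖φ t‖ ≤ C) (hD : ∀ t, ‖ψ t‖ ≤ D) :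
    E.integral (fun t => φ t - ψ t) = E.integral φ - E.integral ψ := by
  refine (isIntegral_integral (hφ.sub hψ) (C := C + D) fun t =>
    norm_sub_le_of_le (hC t) (hD t)).eq_integral fun x => ?_
  rw [_root_.sub_apply, inner_sub_right, (isIntegral_integral hφ hC).inner_apply,
    (isIntegral_integral hψ hD).inner_apply]
  exact (MeasureTheory.integral_sub (integrable_of_bound hφ hC x)
    (integrable_of_bound hψ hD x)).symm

lemma integral_sum {ι : Type*} (s : Finset ι) {φ : ι → ℝ → ℂ} (hφ : ∀ i, Measurable (φ i)) {C : ℝ}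
    (hC : ∀ i t, ‖φ i t‖ ≤ C) :
    E.integral (fun t => ∑ i ∈ s, φ i t) = ∑ i ∈ s, E.integral (φ i) := by
  classical
  induction s using Finset.induction_on with
  | empty => simpa using integral_zero
  | insert i s hi ih =>
    simp only [Finset.sum_insert hi]
    rw [integral_add (hφ i) (Finset.measurable_fun_sum s fun j _ => hφ j) (hC i)
      (D := ∑ j ∈ s, C) (fun t => norm_sum_le_of_le _ fun j _ => hC j t), ih]

lemma inner_integral_left {φ : ℝ → ℂ} (hφ : Measurable φ) {C : ℝ} (hC : ∀ t, ‖φ t‖ ≤ C) (x y : H) :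
    inner ℂ (E.integral (fun t => starRingEnd ℂ (φ t)) x) y = inner ℂ x (E.integral φ y) := by
  have h : E.integral (fun t => starRingEnd ℂ (φ t)) =
      ContinuousLinearMap.adjoint (E.integral φ) := by
    refine (isIntegral_integral (C := C) (Complex.continuous_conj.measurable.comp hφ)
      (fun t => by simpa using hC t)).eq_integral fun x => ?_
    rw [ContinuousLinearMap.adjoint_inner_right, ← inner_conj_symm,
      (isIntegral_integral hφ hC).inner_apply]
    exact integral_conj.symm
  rw [h, ContinuousLinearMap.adjoint_inner_left]

lemma norm_integral_apply_sq {φ : ℝ → ℂ} (hφ : Measurable φ) {C : ℝ} (hC : ∀ t, ‖φ t‖ ≤ C) (x : H) :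
    ‖E.integral φ x‖ ^ 2 = ∫ t, ‖φ t‖ ^ 2 ∂(E.scalar x) :=
  (isIntegral_integral hφ hC).norm_sq x

end Calculus

end SpectralMeasure

/-! ### Families of functions with bounded square sums. -/

/-- The sums of squares `∑_n |φ_n(s)|²` of a family of functions are bounded by `C`. -/
def SqSumLE {ι : Type*} (φ : ι → ℝ → ℂ) (C : ℝ) : Prop :=
  ∀ s, ∀ F : Finset ι, ∑ n ∈ F, ‖φ n s‖ ^ 2 ≤ C

namespace SqSumLE

variable {ι κ : Type*} {φ : ι → ℝ → ℂ} {C : ℝ}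

lemma nonneg (h : SqSumLE φ C) : 0 ≤ C := by simpa using h 0 ∅

lemma norm_le (h : SqSumLE φ C) (n : ι) (s : ℝ) : ‖φ n s‖ ≤ √C :=
  Real.le_sqrt_of_sq_le (by simpa using h s {n})

lemma conj (h : SqSumLE φ C) : SqSumLE (fun n s => starRingEnd ℂ (φ n s)) C := fun s F => by
  simpa using h s F

lemma neg (h : SqSumLE φ C) : SqSumLE (fun n s => -φ n s) C := fun s F => by
  simpa using h s F

lemma comp (h : SqSumLE φ C) (r : ℝ → ℝ) : SqSumLE (fun n s => φ n (r s)) C := fun s F => h (r s) F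

lemma sumElim (h : SqSumLE φ C) {ψ : κ → ℝ → ℂ} {D : ℝ} (h' : SqSumLE ψ D) :
    SqSumLE (Sum.elim φ ψ) (C + D) := by
  intro s F
  have hd : F = F.toLeft.disjSum F.toRight := (Finset.toLeft_disjSum_toRight (u := F)).symm
  rw [hd, Finset.sum_disjSum]
  exact add_le_add (h s _) (h' s _)

lemma norm_sum_mul_le (h : SqSumLE φ C) {ψ : ι → ℝ → ℂ} {D : ℝ} (h' : SqSumLE ψ D) (s t : ℝ)
    (F : Finset ι) : ∑ n ∈ F, ‖φ n s * ψ n t‖ ≤ (C + D) / 2 := by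
  calc ∑ n ∈ F, ‖φ n s * ψ n t‖ ≤ ∑ n ∈ F, (‖φ n s‖ ^ 2 + ‖ψ n t‖ ^ 2) / 2 := by
        gcongr with n
        rw [norm_mul]
        nlinarith [sq_nonneg (‖φ n s‖ - ‖ψ n t‖)]
    _ = (∑ n ∈ F, ‖φ n s‖ ^ 2 + ∑ n ∈ F, ‖ψ n t‖ ^ 2) / 2 := by
        rw [← Finset.sum_add_distrib, Finset.sum_div]
    _ ≤ (C + D) / 2 := by gcongr; exacts [h s F, h' t F]

lemma of_iSup_tsum_le (hC : 0 ≤ C) (h : (⨆ s, ∑' n, ‖φ n s‖ₑ ^ 2) ≤ ENNReal.ofReal C) :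
    SqSumLE φ C := by
  intro s F
  have h1 : ∑ n ∈ F, ‖φ n s‖ₑ ^ 2 ≤ ENNReal.ofReal C :=
    (ENNReal.sum_le_tsum F).trans ((le_iSup (fun s => ∑' n, ‖φ n s‖ₑ ^ 2) s).trans h)
  rw [← ENNReal.ofReal_le_ofReal_iff hC, ENNReal.ofReal_sum_of_nonneg (fun _ _ => by positivity)]
  refine le_of_eq_of_le (Finset.sum_congr rfl fun n _ => ?_) h1
  rw [ENNReal.ofReal_pow (norm_nonneg _), ofReal_norm]

lemma iSup_tsum_le (h : SqSumLE φ C) : (⨆ s, ∑' n, ‖φ n s‖ₑ ^ 2) ≤ ENNReal.ofReal C := by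
  refine iSup_le fun s => ?_
  rw [ENNReal.tsum_eq_iSup_sum]
  refine iSup_le fun F => ?_
  refine le_of_eq_of_le ?_ (ENNReal.ofReal_le_ofReal (h s F))
  rw [ENNReal.ofReal_sum_of_nonneg (fun _ _ => by positivity)]
  refine Finset.sum_congr rfl fun n _ => ?_
  rw [ENNReal.ofReal_pow (norm_nonneg _), ofReal_norm]

end SqSumLE

/-! ### Convergence of double operator integrals and independence of the representation. -/

namespace SpectralMeasure

variable {H : Type*} [NormedAddCommGroup H] [InnerProductSpace ℂ H] [CompleteSpace H]
  {E E₁ E₂ : SpectralMeasure H} {ι : Type*}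

lemma sum_norm_integral_apply_sq_le {ψ : ι → ℝ → ℂ} (hψ : ∀ n, Measurable (ψ n)) {C : ℝ}
    (hC : SqSumLE ψ C) (x : H) (F : Finset ι) :
    ∑ n ∈ F, ‖E.integral (ψ n) x‖ ^ 2 ≤ C * ‖x‖ ^ 2 := by
  have hi : ∀ n ∈ F, Integrable (fun t => ‖ψ n t‖ ^ 2) (E.scalar x) := fun n _ =>
    Integrable.of_bound ((hψ n).norm.pow_const 2).aestronglyMeasurable ((√C) ^ 2)
      (ae_of_all _ fun t => by
        rw [Real.norm_of_nonneg (by positivity)]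
        gcongr
        exact hC.norm_le n t)
  simp only [norm_integral_apply_sq (hψ _) (hC.norm_le _)]
  rw [← integral_finsetSum _ hi]
  calc ∫ t, ∑ n ∈ F, ‖ψ n t‖ ^ 2 ∂(E.scalar x) ≤ ∫ _, C ∂(E.scalar x) :=
        integral_mono (integrable_finsetSum _ hi) (integrable_const _) fun t => hC t F
    _ = C * ‖x‖ ^ 2 := by
        rw [MeasureTheory.integral_const, scalar_real_univ, smul_eq_mul, mul_comm]

/-- The row bound is dual to the column bound: pair the sum with itself, move each operator to the
other side as the integral of the conjugate function, and apply Cauchy–Schwarz. -/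
lemma norm_sum_integral_apply_le {φ : ι → ℝ → ℂ} (hφ : ∀ n, Measurable (φ n)) {C : ℝ}
    (hC : SqSumLE φ C) (b : ι → H) (F : Finset ι) :
    ‖∑ n ∈ F, E.integral (φ n) (b n)‖ ≤ √C * √(∑ n ∈ F, ‖b n‖ ^ 2) := by
  set z := ∑ n ∈ F, E.integral (φ n) (b n) with hz
  have hm : ∀ n, Measurable fun t => starRingEnd ℂ (φ n t) := fun n =>
    Complex.continuous_conj.measurable.comp (hφ n)
  have h1 : ‖z‖ ^ 2 ≤ (√C * √(∑ n ∈ F, ‖b n‖ ^ 2)) * ‖z‖ := by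
    calc ‖z‖ ^ 2 = ‖inner ℂ z z‖ := by rw [inner_self_eq_norm_sq_to_K]; simp
      _ = ‖∑ n ∈ F, inner ℂ (E.integral (fun t => starRingEnd ℂ (φ n t)) z) (b n)‖ := by
        conv_lhs => enter [1, 3]; rw [hz]
        rw [inner_sum]
        simp only [inner_integral_left (hφ _) (hC.norm_le _)]
      _ ≤ ∑ n ∈ F, ‖E.integral (fun t => starRingEnd ℂ (φ n t)) z‖ * ‖b n‖ :=
        norm_sum_le_of_le _ fun n _ => norm_inner_le_norm _ _
      _ ≤ √(∑ n ∈ F, ‖E.integral (fun t => starRingEnd ℂ (φ n t)) z‖ ^ 2) *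
          √(∑ n ∈ F, ‖b n‖ ^ 2) := Real.sum_mul_le_sqrt_mul_sqrt _ _ _
      _ ≤ √(C * ‖z‖ ^ 2) * √(∑ n ∈ F, ‖b n‖ ^ 2) := by
        gcongr
        exact sum_norm_integral_apply_sq_le hm hC.conj z F
      _ = (√C * √(∑ n ∈ F, ‖b n‖ ^ 2)) * ‖z‖ := by
        rw [Real.sqrt_mul hC.nonneg, Real.sqrt_sq (norm_nonneg _)]
        ring
  rcases (norm_nonneg z).eq_or_lt with h0 | h0
  · rw [← h0]; positivity
  · exact le_of_mul_le_mul_right (by rwa [pow_two] at h1) h0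

lemma summable_norm_integral_apply_sq {ψ : ι → ℝ → ℂ} (hψ : ∀ n, Measurable (ψ n)) {C : ℝ}
    (hC : SqSumLE ψ C) (x : H) : Summable fun n => ‖E.integral (ψ n) x‖ ^ 2 :=
  summable_of_sum_le (fun _ => by positivity) (sum_norm_integral_apply_sq_le hψ hC x)

lemma summable_integral_apply {φ : ι → ℝ → ℂ} (hφ : ∀ n, Measurable (φ n)) {C : ℝ}
    (hC : SqSumLE φ C) {b : ι → H} (hb : Summable fun n => ‖b n‖ ^ 2) :
    Summable fun n => E.integral (φ n) (b n) := by
  rw [summable_iff_vanishing_norm]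
  intro ε hε
  obtain ⟨s, hs⟩ := summable_iff_vanishing_norm.1 hb ((ε / (√C + 1)) ^ 2) (by positivity)
  refine ⟨s, fun t ht => ?_⟩
  have h1 := hs t ht
  rw [Real.norm_of_nonneg (Finset.sum_nonneg fun _ _ => by positivity)] at h1
  have h2 : √(∑ n ∈ t, ‖b n‖ ^ 2) < ε / (√C + 1) := by
    rw [Real.sqrt_lt' (by positivity)]
    exact h1
  calc ‖∑ n ∈ t, E.integral (φ n) (b n)‖ ≤ √C * √(∑ n ∈ t, ‖b n‖ ^ 2) :=
        norm_sum_integral_apply_le hφ hC b t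
    _ ≤ √C * (ε / (√C + 1)) := by gcongr
    _ < (√C + 1) * (ε / (√C + 1)) := by gcongr; linarith
    _ = ε := by field_simp

lemma norm_tsum_integral_apply_le {φ : ι → ℝ → ℂ} (hφ : ∀ n, Measurable (φ n)) {C D : ℝ}
    (hC : SqSumLE φ C) {b : ι → H} (hb : Summable fun n => ‖b n‖ ^ 2)
    (hD : ∑' n, ‖b n‖ ^ 2 ≤ D) : ‖∑' n, E.integral (φ n) (b n)‖ ≤ √C * √D := by
  refine le_of_tendsto (summable_integral_apply hφ hC hb).hasSum.norm (Eventually.of_forall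
    fun F => (norm_sum_integral_apply_le hφ hC b F).trans ?_)
  gcongr
  exact (hb.sum_le_tsum F fun _ _ => by positivity).trans hD

/-- The double operator integral of `∑_n φ_n(s) ψ_n(t)`. -/
lemma exists_hasSum_integral_integral {φ ψ : ι → ℝ → ℂ} (hφ : ∀ n, Measurable (φ n))
    (hψ : ∀ n, Measurable (ψ n)) {C D : ℝ} (hC : SqSumLE φ C) (hD : SqSumLE ψ D) :
    ∃ S : H →L[ℂ] H, ∀ x, HasSum (fun n => E₁.integral (φ n) (E₂.integral (ψ n) x)) (S x) := by
  have hs : ∀ x : H, Summable fun n => E₁.integral (φ n) (E₂.integral (ψ n) x) := fun x =>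
    summable_integral_apply hφ hC (summable_norm_integral_apply_sq hψ hD x)
  refine ⟨LinearMap.mkContinuous
    { toFun := fun x => ∑' n, E₁.integral (φ n) (E₂.integral (ψ n) x)
      map_add' := fun x y => by
        simp only [map_add]
        exact (hs x).tsum_add (hs y)
      map_smul' := fun c x => by
        simp only [map_smul]
        exact (hs x).tsum_const_smul c } (√C * √D) fun x => ?_, fun x => (hs x).hasSum⟩
  have hb := summable_norm_integral_apply_sq (E := E₂) hψ hD x
  have h := norm_tsum_integral_apply_le (E := E₁) hφ hC hb (hb.tsum_le_of_sum_le
    (sum_norm_integral_apply_sq_le hψ hD x))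
  rwa [Real.sqrt_mul hD.nonneg, Real.sqrt_sq (norm_nonneg _), ← mul_assoc] at h

/-- By the isometry, the squared norm of a partial sum is the integral of `|∑ c_n ψ_n|²`, which
tends to zero boundedly. Countability of `ι` makes `atTop` on finite sets countably generated, as
dominated convergence requires. -/
lemma hasSum_smul_integral_of_hasSum_zero [Countable ι] {c : ι → ℂ} {ψ : ι → ℝ → ℂ}
    (hψ : ∀ n, Measurable (ψ n)) {C D : ℝ} (hc : ∀ F : Finset ι, ∑ n ∈ F, ‖c n‖ ^ 2 ≤ C)
    (hD : SqSumLE ψ D) (h0 : ∀ t, HasSum (fun n => c n * ψ n t) 0) (x : H) :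
    HasSum (fun n => c n • E.integral (ψ n) x) 0 := by
  have hC : SqSumLE (fun n (_ : ℝ) => c n) C := fun _ F => hc F
  have hb : ∀ n t, ‖c n * ψ n t‖ ≤ √C * √D := fun n t => by
    rw [norm_mul]
    gcongr
    exacts [hC.norm_le n 0, hD.norm_le n t]
  have hF : ∀ F : Finset ι, ‖∑ n ∈ F, c n • E.integral (ψ n) x‖ ^ 2 =
      ∫ t, ‖∑ n ∈ F, c n * ψ n t‖ ^ 2 ∂(E.scalar x) := by
    intro F
    rw [← norm_integral_apply_sq (Finset.measurable_fun_sum F fun n _ => (hψ n).const_mul (c n))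
      (C := ∑ n ∈ F, √C * √D) (fun t => norm_sum_le_of_le _ fun n _ => hb n t),
      integral_sum F (fun n => (hψ n).const_mul (c n)) hb, _root_.sum_apply]
    simp only [integral_const_mul (hψ _) (hD.norm_le _), _root_.smul_apply]
  have h1 : Tendsto (fun F : Finset ι => ∫ t, ‖∑ n ∈ F, c n * ψ n t‖ ^ 2 ∂(E.scalar x)) atTop
      (𝓝 (∫ _, (0 : ℝ) ∂(E.scalar x))) := by
    refine tendsto_integral_filter_of_dominated_convergence (fun _ => ((C + D) / 2) ^ 2) ?_ ?_
      (integrable_const _) ?_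
    · exact Eventually.of_forall fun F => ((Finset.measurable_fun_sum F fun n _ =>
        (hψ n).const_mul (c n)).norm.pow_const 2).aestronglyMeasurable
    · refine Eventually.of_forall fun F => ae_of_all _ fun t => ?_
      rw [Real.norm_of_nonneg (by positivity)]
      gcongr
      exact (norm_sum_le _ _).trans (hC.norm_sum_mul_le hD 0 t F)
    · refine ae_of_all _ fun t => ?_
      have := (h0 t).norm.pow 2
      simpa using this
  simp only [← hF, MeasureTheory.integral_zero] at h1
  have h2 := h1.sqrt
  simp only [Real.sqrt_sq (norm_nonneg _), Real.sqrt_zero] at h2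
  exact tendsto_zero_iff_norm_tendsto_zero.2 h2

lemma integral_comp_simpleFunc {φ : ℝ → ℂ} {C : ℝ} (hC : ∀ t, ‖φ t‖ ≤ C)
    (r : SimpleFunc ℝ ℝ) :
    E.integral (fun t => φ (r t)) =
      ∑ d ∈ r.range, φ d • E.integral ((r ⁻¹' {d}).indicator fun _ => 1) := by
  classical
  have h1 : ∀ d, Measurable ((r ⁻¹' {d}).indicator fun _ => (1 : ℂ)) := fun d =>
    measurable_const.indicator (r.measurableSet_preimage _)
  have h2 : ∀ d t, ‖(r ⁻¹' {d}).indicator (fun _ => (1 : ℂ)) t‖ ≤ 1 := fun d t => by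
    refine (norm_indicator_le_norm_self _ _).trans (by simp)
  have h3 : (fun t => φ (r t)) =
      fun t => ∑ d ∈ r.range, φ d * (r ⁻¹' {d}).indicator (fun _ => (1 : ℂ)) t := by
    ext t
    rw [Finset.sum_eq_single (r t)]
    · simp
    · intro d _ hd
      rw [indicator_of_notMem, mul_zero]
      exact fun h => hd h.symm
    · exact fun h => absurd (r.mem_range_self t) h
  rw [h3, integral_sum _ (fun d => (h1 d).const_mul (φ d)) (C := C * 1) fun d t => by
    rw [norm_mul]
    exact mul_le_mul (hC d) (h2 d t) (norm_nonneg _) ((norm_nonneg _).trans (hC 0))]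
  exact Finset.sum_congr rfl fun d _ => integral_const_mul (h1 d) (h2 d) (φ d)

/-- The approximants are samples `φ n ∘ r` of the functions themselves, with one `r` for the whole
finite set. Hence they inherit every pointwise relation and bound that holds for the family. -/
lemma exists_simpleFunc_tendsto (F : Finset ι) {φ : ι → ℝ → ℂ} (hφ : ∀ n, Measurable (φ n)) :
    ∃ r : ℕ → SimpleFunc ℝ ℝ, ∀ n ∈ F, ∀ s, Tendsto (fun j => φ n (r j s)) atTop (𝓝 (φ n s)) := by
  let f : ℝ → (F → ℂ) := fun s n => φ n s
  have hf : Measurable f := measurable_pi_lambda _ fun n => hφ n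
  have h0 : f 0 ∈ range f := mem_range_self 0
  let g := SimpleFunc.approxOn f hf (range f) (f 0) h0
  have hg : ∀ s, Tendsto (fun j => g j s) atTop (𝓝 (f s)) := fun s =>
    SimpleFunc.tendsto_approxOn hf h0 (subset_closure (mem_range_self s))
  refine ⟨fun j => (g j).map (Function.invFun f), fun n hn s => ?_⟩
  have h1 : ∀ j, f (Function.invFun f (g j s)) = g j s := fun j =>
    Function.invFun_eq (SimpleFunc.approxOn_mem hf h0 j s)
  have h2 := (tendsto_pi_nhds.1 (hg s)) ⟨n, hn⟩
  refine h2.congr fun j => ?_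
  rw [← h1 j]
  rfl

/-- Replace `φ n` by samples `φ n ∘ r` with `r` simple. For each value of `r` the relation in `t`
alone yields zero, so the sampled series sums to zero. Sampling keeps the square-sum bound `C`, so
the tails outside a finite set `F` are small for both series, uniformly in `r`. On `F` the samples
converge in `L²` of the scalar measures of `b n`. -/
lemma hasSum_integral_integral_zero [Countable ι] {φ ψ : ι → ℝ → ℂ} (hφ : ∀ n, Measurable (φ n))
    (hψ : ∀ n, Measurable (ψ n)) {C D : ℝ} (hC : SqSumLE φ C) (hD : SqSumLE ψ D)
    (h0 : ∀ s t, HasSum (fun n => φ n s * ψ n t) 0) (x : H) :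
    HasSum (fun n => E₁.integral (φ n) (E₂.integral (ψ n) x)) 0 := by
  classical
  set b : ι → H := fun n => E₂.integral (ψ n) x with hb
  have hbs : Summable fun n => ‖b n‖ ^ 2 := summable_norm_integral_apply_sq hψ hD x
  have hsum := (summable_integral_apply (E := E₁) hφ hC hbs).hasSum
  set V := ∑' n, E₁.integral (φ n) (b n)
  have hstep : ∀ r : SimpleFunc ℝ ℝ,
      HasSum (fun n => E₁.integral (fun s => φ n (r s)) (b n)) 0 := by
    intro r
    simp only [integral_comp_simpleFunc (hC.norm_le _) r, _root_.sum_apply, _root_.smul_apply]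
    rw [← Finset.sum_const_zero (s := r.range)]
    refine hasSum_sum fun d _ => ?_
    have h1 := (hasSum_smul_integral_of_hasSum_zero (E := E₂) (c := fun n => φ n d) hψ (hC d) hD
      (h0 d) x).mapL (E₁.integral ((r ⁻¹' {d}).indicator fun _ => 1))
    simpa using h1
  have hsmall : ∀ ε > 0, ‖V‖ ≤ 2 * (√C * ε) := by
    intro ε hε
    obtain ⟨F, hF⟩ := summable_iff_vanishing_norm.1 hbs (ε ^ 2) (by positivity)
    have htail : ∀ {θ : ι → ℝ → ℂ}, (∀ n, Measurable (θ n)) → SqSumLE θ C → ∀ G : Finset ι,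
        ‖∑ n ∈ G \ F, E₁.integral (θ n) (b n)‖ ≤ √C * ε := by
      intro θ hθ hθC G
      refine (norm_sum_integral_apply_le hθ hθC b _).trans ?_
      gcongr
      refine Real.sqrt_le_iff.2 ⟨hε.le, ?_⟩
      have := hF (G \ F) Finset.sdiff_disjoint
      exact ((le_abs_self _).trans_lt this).le
    obtain ⟨r, hr⟩ := exists_simpleFunc_tendsto F hφ
    have hmr : ∀ j n, Measurable fun s => φ n (r j s) := fun j n => (hφ n).comp (r j).measurable
    have hj : ∀ j, ‖V‖ ≤ ∑ n ∈ F, ‖E₁.integral (φ n) (b n) -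
        E₁.integral (fun s => φ n (r j s)) (b n)‖ + 2 * (√C * ε) := by
      intro j
      have hlim := (hsum.sub (hstep (r j))).norm
      rw [sub_zero] at hlim
      refine le_of_tendsto hlim ?_
      filter_upwards [eventually_ge_atTop F] with G hG
      rw [← Finset.sum_sdiff hG, add_comm]
      refine (norm_add_le _ _).trans (add_le_add (norm_sum_le _ _) ?_)
      rw [Finset.sum_sub_distrib, two_mul]
      exact (norm_sub_le _ _).trans (add_le_add (htail hφ hC G)
        (htail (hmr j) (hC.comp (r j)) G))
    have hlim : Tendsto (fun j => ∑ n ∈ F, ‖E₁.integral (φ n) (b n) -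
        E₁.integral (fun s => φ n (r j s)) (b n)‖ + 2 * (√C * ε)) atTop
        (𝓝 (∑ n ∈ F, 0 + 2 * (√C * ε))) := by
      refine (tendsto_finsetSum F fun n hn => ?_).add_const _
      have h1 : ∀ j, ‖E₁.integral (φ n) (b n) - E₁.integral (fun s => φ n (r j s)) (b n)‖ ^ 2 =
          ∫ s, ‖φ n s - φ n (r j s)‖ ^ 2 ∂(E₁.scalar (b n)) := by
        intro j
        rw [← _root_.sub_apply, ← integral_sub (hφ n) (hmr j n) (hC.norm_le n)
          ((hC.comp (r j)).norm_le n)]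
        exact norm_integral_apply_sq ((hφ n).sub (hmr j n))
          (fun s => norm_sub_le_of_le (hC.norm_le n s) ((hC.comp (r j)).norm_le n s)) _
      have h2 : Tendsto (fun j => ∫ s, ‖φ n s - φ n (r j s)‖ ^ 2 ∂(E₁.scalar (b n))) atTop
          (𝓝 (∫ _, (0 : ℝ) ∂(E₁.scalar (b n)))) := by
        refine tendsto_integral_of_dominated_convergence (fun _ => (√C + √C) ^ 2)
          (fun j => (((hφ n).sub (hmr j n)).norm.pow_const 2).aestronglyMeasurable)
          (integrable_const _) (fun j => ae_of_all _ fun s => ?_) (ae_of_all _ fun s => ?_)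
        · rw [Real.norm_of_nonneg (by positivity)]
          gcongr
          exact norm_sub_le_of_le (hC.norm_le n s) ((hC.comp (r j)).norm_le n s)
        · simpa using ((tendsto_const_nhds (x := φ n s)).sub (hr n hn s)).norm.pow 2
      simp only [← h1, MeasureTheory.integral_zero] at h2
      have h3 := h2.sqrt
      simpa only [Real.sqrt_sq (norm_nonneg _), Real.sqrt_zero] using h3
    simpa using ge_of_tendsto' hlim hj
  have hV : V = 0 := by
    have h1 : Tendsto (fun ε : ℝ => 2 * (√C * ε)) (𝓝[>] 0) (𝓝 (2 * (√C * 0))) :=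
      ((Continuous.tendsto (by fun_prop) 0).mono_left nhdsWithin_le_nhds)
    rw [mul_zero, mul_zero] at h1
    exact norm_le_zero_iff.1 (ge_of_tendsto h1 (eventually_mem_nhdsWithin.mono hsmall))
  rwa [hV] at hsum

/-- The difference of two representations is a representation of zero indexed by the disjoint union,
with the sign put on the right factor. -/
lemma hasSum_integral_integral_unique {κ : Type*} [Countable ι] [Countable κ]
    {φ ψ : ι → ℝ → ℂ} {φ' ψ' : κ → ℝ → ℂ} (hφ : ∀ n, Measurable (φ n))
    (hψ : ∀ n, Measurable (ψ n)) (hφ' : ∀ n, Measurable (φ' n)) (hψ' : ∀ n, Measurable (ψ' n))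
    {C D C' D' : ℝ} (hC : SqSumLE φ C) (hD : SqSumLE ψ D) (hC' : SqSumLE φ' C')
    (hD' : SqSumLE ψ' D') {Φ : ℝ → ℝ → ℂ} (h : ∀ s t, HasSum (fun n => φ n s * ψ n t) (Φ s t))
    (h' : ∀ s t, HasSum (fun n => φ' n s * ψ' n t) (Φ s t)) {x u v : H}
    (hu : HasSum (fun n => E₁.integral (φ n) (E₂.integral (ψ n) x)) u)
    (hv : HasSum (fun n => E₁.integral (φ' n) (E₂.integral (ψ' n) x)) v) : u = v := by
  have h1 := hasSum_integral_integral_zero (E₁ := E₁) (E₂ := E₂) (ι := ι ⊕ κ)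
    (φ := Sum.elim φ φ') (ψ := Sum.elim ψ fun n t => -ψ' n t)
    (by rintro (n | n); exacts [hφ n, hφ' n]) (by rintro (n | n); exacts [hψ n, (hψ' n).neg])
    (hC.sumElim hC') (hD.sumElim hD'.neg) (fun s t => by
      rw [← add_neg_cancel (Φ s t)]
      refine HasSum.sum (h s t) ?_
      simpa [Function.comp_def] using (h' s t).neg) x
  have hneg : ∀ n, E₂.integral (fun t => -ψ' n t) = -E₂.integral (ψ' n) := fun n => by
    simpa using integral_const_mul (E := E₂) (hψ' n) (hD'.norm_le n) (-1)
  have h2 : HasSum (fun n : ι ⊕ κ => E₁.integral (Sum.elim φ φ' n)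
      (E₂.integral (Sum.elim ψ (fun n t => -ψ' n t) n) x)) (u + -v) := by
    refine HasSum.sum hu ?_
    simpa [Function.comp_def, hneg] using hv.neg
  exact eq_of_sub_eq_zero (by rw [sub_eq_add_neg]; exact h2.unique h1)

end SpectralMeasure

lemma IsHaagerupRep.exists_sqSumLE {Φ : ℝ → ℝ → ℂ} {φ ψ : ℕ → ℝ → ℂ} (h : IsHaagerupRep Φ φ ψ) :
    ∃ C D, SqSumLE φ C ∧ SqSumLE ψ D :=
  ⟨_, _, SqSumLE.of_iSup_tsum_le ENNReal.toReal_nonneg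
    (ENNReal.ofReal_toReal h.bounded_left.ne).ge, SqSumLE.of_iSup_tsum_le ENNReal.toReal_nonneg
    (ENNReal.ofReal_toReal h.bounded_right.ne).ge⟩

section

variable {H : Type*} [NormedAddCommGroup H] [InnerProductSpace ℂ H] [CompleteSpace H]
  {E₁ E₂ : SpectralMeasure H} {Φ : ℝ → ℝ → ℂ}

lemma MemHaagerup.exists_isDoubleOperatorIntegral (h : MemHaagerup Φ) :
    ∃ S, IsDoubleOperatorIntegral E₁ E₂ Φ 1 S := by
  obtain ⟨φ, ψ, hr⟩ := h
  obtain ⟨C, D, hC, hD⟩ := hr.exists_sqSumLE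
  obtain ⟨S, hS⟩ := SpectralMeasure.exists_hasSum_integral_integral (E₁ := E₁) (E₂ := E₂)
    hr.measurable_left hr.measurable_right hC hD
  refine ⟨S, ⟨φ, ψ, hr⟩, fun φ' ψ' hr' x y => ?_⟩
  obtain ⟨C', D', hC', hD'⟩ := hr'.exists_sqSumLE
  obtain ⟨S', hS'⟩ := SpectralMeasure.exists_hasSum_integral_integral (E₁ := E₁) (E₂ := E₂)
    hr'.measurable_left hr'.measurable_right hC' hD'
  have h1 : S x = S' x := SpectralMeasure.hasSum_integral_integral_unique hr.measurable_left
    hr.measurable_right hr'.measurable_left hr'.measurable_right hC hD hC' hD' hr.hasSum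
    hr'.hasSum (hS x) (hS' x)
  rw [h1]
  exact (hS' x).mapL (innerSL ℂ y)

lemma IsDoubleOperatorIntegral.unique {Q S S' : H →L[ℂ] H}
    (h : IsDoubleOperatorIntegral E₁ E₂ Φ Q S) (h' : IsDoubleOperatorIntegral E₁ E₂ Φ Q S') :
    S = S' := by
  obtain ⟨φ, ψ, hr⟩ := h.memHaagerup
  ext x
  exact ext_inner_left ℂ fun y => (h.hasSum φ ψ hr x y).unique (h'.hasSum φ ψ hr x y)

lemma existsUnique_isFunctionOfPair {f : Plane → ℂ} (h : MemHaagerup (sharp f))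
    (B : H →ₗ.[ℂ] H) : ∃! F : H →ₗ.[ℂ] H, IsFunctionOfPair E₁ E₂ B f F := by
  obtain ⟨S, hS⟩ := h.exists_isDoubleOperatorIntegral (E₁ := E₁) (E₂ := E₂)
  refine ⟨⟨B.domain, (S : H →ₗ[ℂ] H) ∘ₗ (B.domain.subtype - Complex.I • B.toFun)⟩,
    ⟨rfl, S, hS, fun x y hxy => ?_⟩, fun F ⟨hdom, S', hS', hF⟩ => ?_⟩
  · obtain rfl : x = y := Subtype.ext hxy
    rfl
  · obtain rfl := hS.unique hS'
    exact LinearPMap.ext hdom fun x hx hx' => hF ⟨x, hx⟩ ⟨x, hx'⟩ rfl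

end

/-! ### Building Haagerup representations. -/

/-- The function `Φ` is `∑_n φ_n(s) ψ_n(t)` with Borel functions such that `∑_n |φ_n|² ≤ C` and
`∑_n |ψ_n|² ≤ D`. -/
def HasRepLE (Φ : ℝ → ℝ → ℂ) (C D : ℝ) : Prop :=
  ∃ φ ψ : ℕ → ℝ → ℂ, (∀ n, Measurable (φ n)) ∧ (∀ n, Measurable (ψ n)) ∧ SqSumLE φ C ∧
    SqSumLE ψ D ∧ ∀ s t, HasSum (fun n => φ n s * ψ n t) (Φ s t)

lemma SqSumLE.extend {ι : Type*} {e : ι → ℕ} (he : Function.Injective e) {φ : ι → ℝ → ℂ} {C : ℝ}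
    (h : SqSumLE φ C) : SqSumLE (Function.extend e φ 0) C := by
  refine SqSumLE.of_iSup_tsum_le h.nonneg (le_trans (iSup_mono fun s => ?_) h.iSup_tsum_le)
  rw [← tsum_extend_zero he]
  refine le_of_eq (tsum_congr fun m => ?_)
  by_cases hm : ∃ n, e n = m
  · obtain ⟨n, rfl⟩ := hm
    simp only [he.extend_apply]
  · simp [Function.extend_apply' _ _ _ hm]

lemma HasRepLE.of_countable {ι : Type*} [Countable ι] {Φ : ℝ → ℝ → ℂ} {φ ψ : ι → ℝ → ℂ}
    (hφ : ∀ n, Measurable (φ n)) (hψ : ∀ n, Measurable (ψ n)) {C D : ℝ} (hC : SqSumLE φ C)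
    (hD : SqSumLE ψ D) (h : ∀ s t, HasSum (fun n => φ n s * ψ n t) (Φ s t)) : HasRepLE Φ C D := by
  obtain ⟨e, he⟩ := Countable.exists_injective_nat ι
  have hm : ∀ {θ : ι → ℝ → ℂ}, (∀ n, Measurable (θ n)) →
      ∀ m, Measurable (Function.extend e θ 0 m) := by
    intro θ hθ m
    by_cases hm : ∃ n, e n = m
    · obtain ⟨n, rfl⟩ := hm
      rw [he.extend_apply]
      exact hθ n
    · rw [Function.extend_apply' _ _ _ hm]
      exact measurable_const
  refine ⟨_, _, hm hφ, hm hψ, hC.extend he, hD.extend he, fun s t => ?_⟩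
  rw [← he.hasSum_iff]
  · simpa [Function.comp_def, he.extend_apply] using h s t
  · intro m hm
    rw [Function.extend_apply' _ _ _ (by simpa using hm)]
    simp

lemma HasRepLE.memHaagerup {Φ : ℝ → ℝ → ℂ} {C D : ℝ} (h : HasRepLE Φ C D) : MemHaagerup Φ := by
  obtain ⟨φ, ψ, hφ, hψ, hC, hD, hs⟩ := h
  exact ⟨φ, ψ, hφ, hψ, hC.iSup_tsum_le.trans_lt ENNReal.ofReal_lt_top,
    hD.iSup_tsum_le.trans_lt ENNReal.ofReal_lt_top, hs⟩

lemma HasRepLE.haagerupNorm_le {Φ : ℝ → ℝ → ℂ} {C D : ℝ} (h : HasRepLE Φ C D) :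
    haagerupNorm Φ ≤ (ENNReal.ofReal C * ENNReal.ofReal D) ^ (1 / 2 : ℝ) := by
  obtain ⟨φ, ψ, hφ, hψ, hC, hD, hs⟩ := h
  have hr : IsHaagerupRep Φ φ ψ := ⟨hφ, hψ, hC.iSup_tsum_le.trans_lt ENNReal.ofReal_lt_top,
    hD.iSup_tsum_le.trans_lt ENNReal.ofReal_lt_top, hs⟩
  refine (iInf₂_le_of_le φ ψ (iInf_le _ hr)).trans ?_
  gcongr
  exacts [hC.iSup_tsum_le, hD.iSup_tsum_le]

lemma SqSumLE.uncurry {φ : ℕ → ℕ → ℝ → ℂ} {C : ℝ} {c : ℕ → ℝ} (hc : Summable c)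
    (h : ∀ n, SqSumLE (φ n) (C * c n)) :
    SqSumLE (fun p : ℕ × ℕ => φ p.1 p.2) (C * ∑' n, c n) := by
  classical
  intro s F
  calc ∑ p ∈ F, ‖φ p.1 p.2 s‖ ^ 2
      ≤ ∑ p ∈ F.image Prod.fst ×ˢ F.image Prod.snd, ‖φ p.1 p.2 s‖ ^ 2 :=
        Finset.sum_le_sum_of_subset_of_nonneg Finset.subset_product fun _ _ _ => by positivity
    _ = ∑ n ∈ F.image Prod.fst, ∑ m ∈ F.image Prod.snd, ‖φ n m s‖ ^ 2 := Finset.sum_product _ _ _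
    _ ≤ ∑ n ∈ F.image Prod.fst, C * c n := Finset.sum_le_sum fun n _ => h n s _
    _ ≤ ∑' n, C * c n := (hc.mul_left C).sum_le_tsum _ fun n _ => (h n).nonneg
    _ = C * ∑' n, c n := tsum_mul_left

/-- Both square sums are required to be proportional to the same `c n`, so that concatenation adds
them simultaneously. Together they make the double series absolutely convergent, which permits
summing it fibre by fibre. -/
lemma HasRepLE.hasSum {Φ : ℝ → ℝ → ℂ} {Ψ : ℕ → ℝ → ℝ → ℂ} {C D : ℝ} {c : ℕ → ℝ}
    (hc : Summable c) (h : ∀ n, HasRepLE (Ψ n) (C * c n) (D * c n))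
    (hΦ : ∀ s t, HasSum (fun n => Ψ n s t) (Φ s t)) :
    HasRepLE Φ (C * ∑' n, c n) (D * ∑' n, c n) := by
  choose φ ψ hφ hψ hC hD hs using h
  have hC' := SqSumLE.uncurry hc hC
  have hD' := SqSumLE.uncurry hc hD
  refine HasRepLE.of_countable (φ := fun p : ℕ × ℕ => φ p.1 p.2)
    (ψ := fun p : ℕ × ℕ => ψ p.1 p.2) (fun p => hφ p.1 p.2) (fun p => hψ p.1 p.2) hC' hD'
    fun s t => ?_
  have hsum : Summable fun p : ℕ × ℕ => φ p.1 p.2 s * ψ p.1 p.2 t :=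
    Summable.of_norm (summable_of_sum_le (fun _ => norm_nonneg _)
      fun F => hC'.norm_sum_mul_le hD' s t F)
  have h1 : HasSum (fun n => Ψ n s t) (∑' p : ℕ × ℕ, φ p.1 p.2 s * ψ p.1 p.2 t) :=
    hsum.hasSum.prod_fiberwise fun n => hs n s t
  have h2 := hsum.hasSum
  rwa [← (hΦ s t).unique h1] at h2

lemma Orthonormal.countable {𝕜 V ι : Type*} [RCLike 𝕜] [NormedAddCommGroup V]
    [InnerProductSpace 𝕜 V] [TopologicalSpace.SeparableSpace V] {v : ι → V}
    (hv : Orthonormal 𝕜 v) : Countable ι := by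
  refine Pairwise.countable_of_isOpen_disjoint (s := fun i => Metric.ball (v i) (1 / 2))
    (fun i j hij => ?_) (fun _ => Metric.isOpen_ball)
    (fun i => ⟨v i, Metric.mem_ball_self (by norm_num)⟩)
  refine Metric.ball_disjoint_ball ?_
  have h1 : ‖v i - v j‖ ^ 2 = 2 := by
    rw [@norm_sub_sq 𝕜, hv.2 hij, hv.1 i, hv.1 j]
    norm_num
  rw [dist_eq_norm]
  nlinarith [norm_nonneg (v i - v j)]

/-- Parseval in a Hilbert basis of `L²(ℝ)` expands the integral, and Bessel's inequality bounds the
square sums of the coefficients. Separability makes the basis countable; the coefficients are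
measurable as parameter integrals of jointly measurable functions. -/
lemma HasRepLE.of_integral {a b : ℝ → ℝ → ℂ} (ha : Measurable (Function.uncurry a))
    (hb : Measurable (Function.uncurry b)) {C D : ℝ}
    (ha2 : ∀ s, Integrable fun u => ‖a s u‖ ^ 2) (hb2 : ∀ t, Integrable fun u => ‖b t u‖ ^ 2)
    (hC : ∀ s, ∫ u, ‖a s u‖ ^ 2 ≤ C) (hD : ∀ t, ∫ u, ‖b t u‖ ^ 2 ≤ D) :
    HasRepLE (fun s t => ∫ u, a s u * b t u) C D := by
  -- The conjugate compensates for the inner product being conjugate linear in its first argument.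
  have hA : ∀ s, MemLp (fun u => starRingEnd ℂ (a s u)) 2 (volume : Measure ℝ) := fun s =>
    (memLp_two_iff_integrable_sq_norm (Complex.continuous_conj.measurable.comp
      (ha.of_uncurry_left (x := s))).aestronglyMeasurable).2 (by simpa using ha2 s)
  have hB : ∀ t, MemLp (b t) 2 (volume : Measure ℝ) := fun t =>
    (memLp_two_iff_integrable_sq_norm (hb.of_uncurry_left (x := t)).aestronglyMeasurable).2 (hb2 t)
  have hnorm : ∀ {f : ℝ → ℂ} (hf : MemLp f 2 (volume : Measure ℝ)),
      ‖hf.toLp f‖ ^ 2 = ∫ u, ‖f u‖ ^ 2 := by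
    intro f hf
    have h1 := inner_self_eq_norm_sq_to_K (𝕜 := ℂ) (hf.toLp f)
    rw [L2.inner_def] at h1
    have h2 : ∫ u, inner ℂ (hf.toLp f u) (hf.toLp f u) = ((∫ u, ‖f u‖ ^ 2 : ℝ) : ℂ) := by
      rw [← integral_complex_ofReal]
      refine integral_congr_ae (hf.coeFn_toLp.mono fun u hu => ?_)
      simp only [hu, inner_self_eq_norm_sq_to_K]
      push_cast
      rfl
    rw [h2] at h1
    rw [← Complex.ofReal_inj, h1]
    push_cast
    rfl
  obtain ⟨w, e, -⟩ := exists_hilbertBasis ℂ (Lp ℂ 2 (volume : Measure ℝ))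
  have : Fact ((2 : ℝ≥0∞) ≠ ∞) := ⟨by simp⟩
  have : Countable w := Orthonormal.countable e.orthonormal
  have h1 : ∀ s i, inner ℂ ((hA s).toLp _) (e i) = ∫ u, a s u * e i u := by
    intro s i
    rw [L2.inner_def]
    refine integral_congr_ae ((hA s).coeFn_toLp.mono fun u hu => ?_)
    simp only [hu, RCLike.inner_apply, Complex.conj_conj]
    ring
  have h2 : ∀ t i, inner ℂ (e i) ((hB t).toLp _) = ∫ u, starRingEnd ℂ (e i u) * b t u := by
    intro t i
    rw [L2.inner_def]
    refine integral_congr_ae ((hB t).coeFn_toLp.mono fun u hu => ?_)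
    simp only [hu, RCLike.inner_apply]
    ring
  have he : ∀ i, Measurable fun p : ℝ × ℝ => e i p.2 := fun i =>
    (Lp.stronglyMeasurable (e i)).measurable.comp measurable_snd
  refine HasRepLE.of_countable (φ := fun i s => inner ℂ ((hA s).toLp _) (e i))
    (ψ := fun i t => inner ℂ (e i) ((hB t).toLp _)) (fun i => ?_) (fun i => ?_)
    (fun s F => ?_) (fun t F => ?_) fun s t => ?_
  · simp only [h1]
    exact ((ha.mul (he i)).stronglyMeasurable.integral_prod_right').measurable
  · simp only [h2]
    exact (((Complex.continuous_conj.measurable.comp (he i)).mul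
      hb).stronglyMeasurable.integral_prod_right').measurable
  · simp only [norm_inner_symm _ (e _)]
    refine (e.orthonormal.sum_inner_products_le _).trans ?_
    rw [hnorm]
    simpa using hC s
  · refine (e.orthonormal.sum_inner_products_le _).trans ?_
    rw [hnorm]
    exact hD t
  · have h3 := e.hasSum_inner_mul_inner ((hA s).toLp _) ((hB t).toLp _)
    suffices h4 : ∫ u, a s u * b t u = inner ℂ ((hA s).toLp _) ((hB t).toLp _) by rwa [h4]
    rw [L2.inner_def]
    refine integral_congr_ae ?_
    filter_upwards [(hA s).coeFn_toLp, (hB t).coeFn_toLp] with u hu hu'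
    simp only [hu, hu', RCLike.inner_apply, Complex.conj_conj]
    ring

open FourierTransform

/-! ### Averages along a direction and the Fourier multipliers they realize. -/

section Average

variable {V : Type*} [NormedAddCommGroup V] [InnerProductSpace ℝ V]

/-- The average `x ↦ ∫ K(u) g(x + u v) du` of a function `g` along the direction `v`. -/
def lineAverage (K : ℝ → ℂ) (v : V) (g : V → ℂ) (x : V) : ℂ := ∫ u, K u * g (x + u • v)

variable {K : ℝ → ℂ} {g : V → ℂ} {M : ℝ}

lemma norm_lineAverage_le (hKi : Integrable K) (hM : ∀ x, ‖g x‖ ≤ M) (v x : V) :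
    ‖lineAverage K v g x‖ ≤ (∫ u, ‖K u‖) * M := by
  rw [← integral_mul_const]
  refine norm_integral_le_of_norm_le (hKi.norm.mul_const M) (ae_of_all _ fun u => ?_)
  rw [norm_mul]
  exact mul_le_mul_of_nonneg_left (hM _) (norm_nonneg _)

variable [MeasurableSpace V] [BorelSpace V]

lemma integrable_mul_translate (hKi : Integrable K) (hg : Measurable g) (hM : ∀ x, ‖g x‖ ≤ M)
    (v x : V) : Integrable fun u => K u * g (x + u • v) := by
  refine hKi.mul_bdd (c := M) (hg.comp (by fun_prop)).aestronglyMeasurable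
    (ae_of_all _ fun u => hM _)

/-- A translation along the direction of averaging can be moved onto the kernel, so no regularity of
`g` is needed. -/
lemma norm_lineAverage_translate_sub_le (hKi : Integrable K) (hg : Measurable g)
    (hM : ∀ x, ‖g x‖ ≤ M) (v x : V) (c : ℝ) :
    ‖lineAverage K v g (x + c • v) - lineAverage K v g x‖ ≤ (∫ u, ‖K (u - c) - K u‖) * M := by
  have h1 : lineAverage K v g (x + c • v) = ∫ u, K (u - c) * g (x + u • v) := by
    rw [lineAverage, ← integral_sub_right_eq_self _ c]
    refine integral_congr_ae (ae_of_all _ fun u => ?_)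
    simp only
    congr 2
    module
  have hKc : Integrable fun u => K (u - c) := hKi.comp_sub_right c
  rw [h1, lineAverage, ← integral_sub (integrable_mul_translate hKc hg hM v x)
    (integrable_mul_translate hKi hg hM v x), ← integral_mul_const]
  refine norm_integral_le_of_norm_le ((hKc.sub hKi).norm.mul_const M) (ae_of_all _ fun u => ?_)
  rw [← sub_mul, norm_mul]
  exact mul_le_mul_of_nonneg_left (hM _) (norm_nonneg _)

/-- Regularity gained by averaging along one axis thus survives averaging along the other. -/
lemma norm_lineAverage_sub_le (hKi : Integrable K) (hg : Measurable g)
    (hM : ∀ x, ‖g x‖ ≤ M) (v x y : V) {ε : ℝ} (hε : ∀ z, ‖g (z + y) - g z‖ ≤ ε) :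
    ‖lineAverage K v g (x + y) - lineAverage K v g x‖ ≤ (∫ u, ‖K u‖) * ε := by
  rw [lineAverage, lineAverage, ← integral_sub (integrable_mul_translate hKi hg hM v _)
    (integrable_mul_translate hKi hg hM v x), ← integral_mul_const]
  refine norm_integral_le_of_norm_le (hKi.norm.mul_const ε) (ae_of_all _ fun u => ?_)
  rw [← mul_sub, norm_mul, add_right_comm]
  exact mul_le_mul_of_nonneg_left (hε _) (norm_nonneg _)

variable [FiniteDimensional ℝ V]

/-- Write `k` and `φ` by Fourier inversion and apply Fubini: the character `exp(2πi u ⟨v, ξ⟩)` acts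
as translation by `u • v`. This is the adjoint form of the multiplier, acting on test functions. -/
lemma fourier_smulLeftCLM_fourierInv (k : 𝓢(ℝ, ℂ)) (v : V) (φ : 𝓢(V, ℂ)) (x : V) :
    𝓕 (SchwartzMap.smulLeftCLM ℂ (fun ξ : V => k (inner ℝ v ξ)) (𝓕⁻ φ)) x =
      ∫ u, 𝓕 k u * φ (x - u • v) := by
  have hk : (fun ξ : V => k (inner ℝ v ξ)).HasTemperateGrowth :=
    k.hasTemperateGrowth.comp (innerSL ℝ v).hasTemperateGrowth
  have h1 : ∀ τ : ℝ, k τ = ∫ u : ℝ, Complex.exp (2 * Real.pi * u * τ * Complex.I) * 𝓕 k u := by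
    intro τ
    have h : (𝓕⁻ (𝓕 k) : 𝓢(ℝ, ℂ)) = k := fourierInv_fourier_eq k
    have := DFunLike.congr_fun h τ
    simp only [SchwartzMap.fourierInv_coe, Real.fourierInv_eq'] at this
    rw [← this]
    refine integral_congr_ae (ae_of_all _ fun u => ?_)
    simp [mul_comm, mul_assoc, mul_left_comm]
  have h2 : ∀ y : V, φ y =
      ∫ ξ, Complex.exp (((-2 * Real.pi * inner ℝ ξ y : ℝ) : ℂ) * Complex.I) * (𝓕⁻ φ) ξ := by
    intro y
    have h : (𝓕 (𝓕⁻ φ) : 𝓢(V, ℂ)) = φ := fourier_fourierInv_eq φ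
    have := DFunLike.congr_fun h y
    simp only [SchwartzMap.fourier_coe, Real.fourier_eq'] at this
    rw [← this]
    rfl
  rw [SchwartzMap.fourier_coe, Real.fourier_eq']
  simp only [SchwartzMap.smulLeftCLM_apply_apply hk, smul_eq_mul]
  simp only [h2, h1 (inner ℝ v _), ← integral_const_mul, ← integral_mul_const]
  rw [integral_integral_swap]
  · refine integral_congr_ae (ae_of_all _ fun u => integral_congr_ae (ae_of_all _ fun ξ => ?_))
    simp only
    have h3 : Complex.exp (((-2 * Real.pi * inner ℝ ξ (x - u • v) : ℝ) : ℂ) * Complex.I) =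
        Complex.exp (((-2 * Real.pi * inner ℝ ξ x : ℝ) : ℂ) * Complex.I) *
          Complex.exp (2 * Real.pi * u * (inner ℝ v ξ : ℝ) * Complex.I) := by
      rw [← Complex.exp_add]
      congr 1
      rw [inner_sub_right, inner_smul_right, real_inner_comm ξ v]
      push_cast
      ring
    rw [h3]
    ring
  · have h4 : Integrable (fun z : V × ℝ => (𝓕⁻ φ) z.1 * 𝓕 k z.2) (volume.prod volume) :=
      (𝓕⁻ φ).integrable.mul_prod (𝓕 k).integrable
    refine h4.mono ?_ (ae_of_all _ fun z => ?_)
    · refine Continuous.aestronglyMeasurable ?_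
      have := (𝓕⁻ φ).continuous
      have := (𝓕 k).continuous
      unfold Function.uncurry
      fun_prop
    · simp only [Function.uncurry, norm_mul]
      have h5 : ‖Complex.exp (2 * Real.pi * z.2 * (inner ℝ v z.1 : ℝ) * Complex.I)‖ = 1 := by
        have := Complex.norm_exp_ofReal_mul_I (2 * Real.pi * z.2 * inner ℝ v z.1)
        push_cast at this
        exact this
      rw [Complex.norm_exp_ofReal_mul_I, h5]
      simp only [one_mul]
      rw [mul_comm]

lemma integral_mul_lineAverage (hK : Continuous K) (hKi : Integrable K) (hg : Measurable g)
    (hM : ∀ x, ‖g x‖ ≤ M) (v : V) (φ : 𝓢(V, ℂ)) :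
    ∫ x, (∫ u, K u * φ (x - u • v)) * g x = ∫ x, φ x * lineAverage K v g x := by
  have h1 : Integrable (fun z : V × ℝ => K z.2 * φ (z.1 - z.2 • v)) (volume.prod volume) := by
    have hc : Continuous fun z : V × ℝ => K z.2 * φ (z.1 - z.2 • v) := by
      have := φ.continuous
      fun_prop
    rw [integrable_prod_iff' hc.aestronglyMeasurable]
    refine ⟨ae_of_all _ fun u => ((φ.integrable.comp_sub_right (u • v)).const_mul (K u)), ?_⟩
    simp only [norm_mul, integral_const_mul]
    refine (hKi.norm.mul_const (∫ x, ‖φ x‖)).congr (ae_of_all _ fun u => ?_)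
    simp only
    rw [integral_sub_right_eq_self (fun x => ‖φ x‖) (u • v)]
  have h2 : Integrable (fun z : V × ℝ => g z.1 * (K z.2 * φ (z.1 - z.2 • v)))
      (volume.prod volume) :=
    h1.bdd_mul (hg.comp measurable_fst).aestronglyMeasurable (ae_of_all _ fun z => hM z.1)
  have h3 : Integrable (fun z : V × ℝ => φ z.1 * (K z.2 * g (z.1 + z.2 • v)))
      (volume.prod volume) := by
    have h4 := (φ.integrable (μ := volume)).mul_prod hKi
    have h5 := h4.bdd_mul (c := M) (f := fun z : V × ℝ => g (z.1 + z.2 • v))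
      (hg.comp (by fun_prop)).aestronglyMeasurable (ae_of_all _ fun z => hM _)
    refine h5.congr (ae_of_all _ fun z => ?_)
    simp only
    ring
  calc ∫ x, (∫ u, K u * φ (x - u • v)) * g x
      = ∫ x, ∫ u, g x * (K u * φ (x - u • v)) := by
        refine integral_congr_ae (ae_of_all _ fun x => ?_)
        simp only
        rw [mul_comm, integral_const_mul]
    _ = ∫ u, ∫ x, g x * (K u * φ (x - u • v)) := integral_integral_swap h2
    _ = ∫ u, ∫ x, φ x * (K u * g (x + u • v)) := by
        refine integral_congr_ae (ae_of_all _ fun u => ?_)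
        simp only
        rw [← integral_add_right_eq_self _ (u • v)]
        refine integral_congr_ae (ae_of_all _ fun x => ?_)
        simp only [add_sub_cancel_right]
        ring
    _ = ∫ x, ∫ u, φ x * (K u * g (x + u • v)) := (integral_integral_swap h3).symm
    _ = ∫ x, φ x * lineAverage K v g x := by
        refine integral_congr_ae (ae_of_all _ fun x => ?_)
        simp only [lineAverage, integral_const_mul]

lemma measurable_lineAverage (hK : Continuous K) (hg : Measurable g) (v : V) :
    Measurable (lineAverage K v g) := by
  have h : Measurable fun z : V × ℝ => K z.2 * g (z.1 + z.2 • v) :=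
    (hK.measurable.comp measurable_snd).mul (hg.comp (by fun_prop))
  exact h.stronglyMeasurable.integral_prod_right'.measurable

end Average

/-! ### Kernels with quadratic decay. -/

section Kernel

variable {K : ℝ → ℂ} {D : ℝ}

lemma integrable_of_decay (hK : Continuous K) (hD : ∀ u, ‖K u‖ ≤ D * (1 + u ^ 2)⁻¹) :
    Integrable K :=
  (integrable_inv_one_add_sq.const_mul D).mono' hK.aestronglyMeasurable (ae_of_all _ hD)

lemma integral_norm_le_of_decay (hK : Continuous K) (hD : ∀ u, ‖K u‖ ≤ D * (1 + u ^ 2)⁻¹) :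
    ∫ u, ‖K u‖ ≤ D * Real.pi := by
  rw [← integral_univ_inv_one_add_sq, ← integral_const_mul]
  exact integral_mono (integrable_of_decay hK hD).norm (integrable_inv_one_add_sq.const_mul D) hD

lemma exists_decay (k : 𝓢(ℝ, ℂ)) : ∃ D : ℝ, 0 ≤ D ∧ ∀ u, ‖k u‖ ≤ D * (1 + u ^ 2)⁻¹ := by
  obtain ⟨A, hA, hA'⟩ := k.decay 0 0
  obtain ⟨B, hB, hB'⟩ := k.decay 2 0
  refine ⟨A + B, by positivity, fun u => ?_⟩
  have h1 := hA' u
  have h2 := hB' u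
  simp only [pow_zero, norm_iteratedFDeriv_zero, one_mul, Real.norm_eq_abs, sq_abs] at h1 h2
  rw [← div_eq_mul_inv, le_div_iff₀ (by positivity)]
  linarith

lemma tendsto_integral_norm_translate_sub (hK : Continuous K)
    (hD : ∀ u, ‖K u‖ ≤ D * (1 + u ^ 2)⁻¹) :
    Tendsto (fun c => ∫ u, ‖K (u - c) - K u‖) (𝓝 0) (𝓝 0) := by
  have hD0 : 0 ≤ D := by simpa using (norm_nonneg _).trans (hD 0)
  have h0 : (0 : ℝ) = ∫ _ : ℝ, (0 : ℝ) := by simp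
  conv => enter [3, 1]; rw [h0]
  refine tendsto_integral_filter_of_dominated_convergence (fun u => 4 * D * (1 + u ^ 2)⁻¹) ?_ ?_
    (integrable_inv_one_add_sq.const_mul _) ?_
  · exact Eventually.of_forall fun c => Continuous.aestronglyMeasurable (by fun_prop)
  · filter_upwards [Metric.ball_mem_nhds (0 : ℝ) one_pos] with c hc
    refine ae_of_all _ fun u => ?_
    rw [mem_ball_zero_iff, Real.norm_eq_abs] at hc
    have hc2 : c ^ 2 ≤ 1 := by rw [← sq_abs]; exact pow_le_one₀ (abs_nonneg _) hc.le
    rw [norm_norm]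
    -- A dominating function independent of `c`: for `|c| ≤ 1` one has `1 + u² ≤ 3 (1 + (u - c)²)`.
    have h1 : (1 + (u - c) ^ 2)⁻¹ ≤ 3 * (1 + u ^ 2)⁻¹ := by
      rw [← div_eq_mul_inv, le_div_iff₀ (by positivity), inv_mul_le_iff₀ (by positivity)]
      nlinarith [sq_nonneg (u - 2 * c), sq_nonneg (u - c)]
    calc ‖K (u - c) - K u‖ ≤ D * (1 + (u - c) ^ 2)⁻¹ + D * (1 + u ^ 2)⁻¹ :=
          norm_sub_le_of_le (hD _) (hD _)
      _ ≤ D * (3 * (1 + u ^ 2)⁻¹) + D * (1 + u ^ 2)⁻¹ := by gcongr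
      _ = 4 * D * (1 + u ^ 2)⁻¹ := by ring
  · refine ae_of_all _ fun u => ?_
    have h1 : Continuous fun c => ‖K (u - c) - K u‖ := by fun_prop
    simpa using h1.tendsto 0

end Kernel

/-! ### Continuity of the averages, and the factorization through `L²`. -/

section Plane

/-- The scaled basis vector of the plane. -/
def axis (h : ℝ) (j : Fin 2) : Plane := EuclideanSpace.single j h

lemma add_smul_axis_one (s t h u : ℝ) : !₂[s, t] + u • axis h 1 = !₂[s, t + h * u] := by
  ext i
  fin_cases i <;> simp [axis, mul_comm]

variable {K : ℝ → ℂ} {D M : ℝ} {g : Plane → ℂ}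

/-- A displacement in the plane is split into multiples of the two axis vectors. The outer kernel
controls the second component, the inner kernel the first. -/
lemma continuous_lineAverage_lineAverage (hK : Continuous K)
    (hD : ∀ u, ‖K u‖ ≤ D * (1 + u ^ 2)⁻¹) (hg : Measurable g) (hM : ∀ x, ‖g x‖ ≤ M) {h : ℝ}
    (hh : h ≠ 0) : Continuous (lineAverage K (axis h 1) (lineAverage K (axis h 0) g)) := by
  have hKi := integrable_of_decay hK hD
  set g₁ := lineAverage K (axis h 0) g with hg₁
  have hm : Measurable g₁ := measurable_lineAverage hK hg _
  have hb : ∀ x, ‖g₁ x‖ ≤ (∫ u, ‖K u‖) * M := norm_lineAverage_le hKi hM _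
  rw [continuous_iff_continuousAt]
  intro x₀
  rw [ContinuousAt, tendsto_iff_norm_sub_tendsto_zero]
  let c : Fin 2 → Plane → ℝ := fun j x => (x j - x₀ j) / h
  have hdec : ∀ x, x = x₀ + c 0 x • axis h 0 + c 1 x • axis h 1 := by
    intro x
    ext i
    fin_cases i <;> simp [axis, c, hh]
  have hbound : ∀ x, ‖lineAverage K (axis h 1) g₁ x - lineAverage K (axis h 1) g₁ x₀‖ ≤
      (∫ u, ‖K (u - c 1 x) - K u‖) * ((∫ u, ‖K u‖) * M) +
        (∫ u, ‖K u‖) * ((∫ u, ‖K (u - c 0 x) - K u‖) * M) := by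
    intro x
    conv_lhs => rw [hdec x]
    refine (norm_sub_le_norm_sub_add_norm_sub _
      (lineAverage K (axis h 1) g₁ (x₀ + c 0 x • axis h 0)) _).trans (add_le_add ?_ ?_)
    · exact norm_lineAverage_translate_sub_le hKi hm hb _ _ _
    · exact norm_lineAverage_sub_le hKi hm hb _ _ _ fun z =>
        norm_lineAverage_translate_sub_le hKi hg hM _ _ _
  have hc : ∀ j, Tendsto (c j) (𝓝 x₀) (𝓝 0) := by
    intro j
    have h1 : Continuous (c j) := by fun_prop
    have h2 := h1.tendsto x₀
    simpa [c] using h2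
  have hω := fun j => (tendsto_integral_norm_translate_sub hK hD).comp (hc j)
  have hlim := ((hω 1).mul_const ((∫ u, ‖K u‖) * M)).add
    (((hω 0).mul_const M).const_mul (∫ u, ‖K u‖))
  simp only [zero_mul, mul_zero, add_zero] at hlim
  exact squeeze_zero (fun _ => norm_nonneg _) hbound hlim

lemma norm_one_sub_I_mul_sq (t : ℝ) : ‖1 - Complex.I * t‖ ^ 2 = 1 + t ^ 2 := by
  rw [Complex.sq_norm, Complex.normSq_apply]
  simp
  ring

lemma one_sub_I_mul_ne_zero (t : ℝ) : (1 - Complex.I * t : ℂ) ≠ 0 := by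
  intro h
  have := norm_one_sub_I_mul_sq t
  rw [h, norm_zero] at this
  nlinarith [sq_nonneg t]

/-- With `v = t + hu`, insert `(1 - iv)⁻¹ (1 - iv)` under the integral. One factor makes `g(s, ·)`
square integrable; the other is absorbed by `(1 - it)⁻¹` and the decay of `K`. -/
lemma hasRepLE_sharp_lineAverage (hK : Continuous K)
    (hD : ∀ u, ‖K u‖ ≤ D * (1 + u ^ 2)⁻¹) (hg : Measurable g) (hM : ∀ x, ‖g x‖ ≤ M) {h : ℝ}
    (hh : 0 < h) (hh1 : h ≤ 1) :
    HasRepLE (sharp (lineAverage K (axis h 1) g)) (Real.pi * (M * h⁻¹))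
      (2 * D ^ 2 * Real.pi * (M * h⁻¹)) := by
  have hM0 : 0 ≤ M := (norm_nonneg _).trans (hM 0)
  have hD0 : 0 ≤ D := by simpa using (norm_nonneg _).trans (hD 0)
  -- The factor `√M` is moved from `g` to the kernel, so that both square integrals are linear in
  -- `M` and thus summable over the blocks. If `M = 0`, then `r⁻¹ = 0` and `g = 0`.
  set r : ℂ := ((√M : ℝ) : ℂ) with hr
  have hr2 : ‖r‖ ^ 2 = M := by
    rw [hr, Complex.norm_real, Real.norm_of_nonneg (Real.sqrt_nonneg _), Real.sq_sqrt hM0]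
  have hrg : ∀ x, r * (r⁻¹ * g x) = g x := by
    intro x
    rcases hM0.eq_or_lt with h0 | h0
    · have : g x = 0 := norm_le_zero_iff.1 (h0 ▸ hM x)
      simp [this]
    · rw [mul_inv_cancel_left₀]
      rw [hr]
      exact_mod_cast (Real.sqrt_pos.2 h0).ne'
  have hrM : ∀ x, ‖r⁻¹ * g x‖ ^ 2 ≤ M := by
    intro x
    rw [norm_mul, mul_pow, norm_inv, inv_pow, hr2]
    rcases hM0.eq_or_lt with h0 | h0
    · simp [← h0]
    · rw [inv_mul_le_iff₀ h0, ← pow_two]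
      exact pow_le_pow_left₀ (norm_nonneg _) (hM x) 2
  let a : ℝ → ℝ → ℂ := fun s v => (r⁻¹ * g !₂[s, v]) * (1 - Complex.I * v)⁻¹
  let b : ℝ → ℝ → ℂ := fun t v =>
    r * ((1 - Complex.I * t)⁻¹ * (1 - Complex.I * v) * (((h⁻¹ : ℝ) : ℂ) * K ((v - t) / h)))
  have hmk : Measurable fun p : ℝ × ℝ => (!₂[p.1, p.2] : Plane) := by
    refine Continuous.measurable ?_
    fun_prop
  have ha : Measurable (Function.uncurry a) :=
    ((hg.comp hmk).const_mul _).mul (by fun_prop)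
  have hb : Measurable (Function.uncurry b) := by
    have := hK.measurable
    unfold Function.uncurry
    fun_prop
  have ha2 : ∀ s v, ‖a s v‖ ^ 2 ≤ M * (1 + v ^ 2)⁻¹ := by
    intro s v
    simp only [a]
    rw [norm_mul, mul_pow, norm_inv, inv_pow, norm_one_sub_I_mul_sq]
    gcongr
    exact hrM _
  have hb2 : ∀ t v, ‖b t v‖ ^ 2 ≤ (2 * D ^ 2 * M * h⁻¹ ^ 2) * (1 + ((v - t) / h) ^ 2)⁻¹ := by
    intro t v
    simp only [b]
    set u := (v - t) / h with hu
    have hv : v = t + h * u := by rw [hu]; field_simp; ring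
    simp only [norm_mul, mul_pow, norm_inv, inv_pow, norm_one_sub_I_mul_sq, hr2, Complex.norm_real,
      Real.norm_of_nonneg hh.le]
    have h1 : ‖K u‖ ^ 2 ≤ (D * (1 + u ^ 2)⁻¹) ^ 2 := by gcongr; exact hD u
    -- The only place where `h ≤ 1` affects the kernel: the weight `1 + v²` costs one factor `1 +
    -- u²`, and `‖K u‖²` decays like the inverse square of it.
    have h2 : (1 + v ^ 2) ≤ 2 * (1 + t ^ 2) * (1 + u ^ 2) := by
      have h3 : h ^ 2 * u ^ 2 ≤ 1 * u ^ 2 := by gcongr; exact pow_le_one₀ hh.le hh1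
      rw [hv]
      nlinarith [sq_nonneg (t - h * u), mul_nonneg (sq_nonneg t) (sq_nonneg u)]
    calc M * ((1 + t ^ 2)⁻¹ * (1 + v ^ 2) * ((h ^ 2)⁻¹ * ‖K u‖ ^ 2))
        ≤ M * ((1 + t ^ 2)⁻¹ * (2 * (1 + t ^ 2) * (1 + u ^ 2)) *
          ((h ^ 2)⁻¹ * (D * (1 + u ^ 2)⁻¹) ^ 2)) := by gcongr
      _ = 2 * D ^ 2 * M * (h ^ 2)⁻¹ * (1 + u ^ 2)⁻¹ := by field_simp
  have hib : ∀ t, Integrable fun v => (1 + ((v - t) / h) ^ 2)⁻¹ := fun t =>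
    (integrable_inv_one_add_sq.comp_div hh.ne').comp_sub_right t
  have hia2 : ∀ s, Integrable fun v => ‖a s v‖ ^ 2 := fun s =>
    (integrable_inv_one_add_sq.const_mul M).mono'
      ((ha.of_uncurry_left (x := s)).norm.pow_const 2).aestronglyMeasurable
      (ae_of_all _ fun v => by rw [Real.norm_of_nonneg (by positivity)]; exact ha2 s v)
  have hib2 : ∀ t, Integrable fun v => ‖b t v‖ ^ 2 := fun t =>
    ((hib t).const_mul _).mono'
      ((hb.of_uncurry_left (x := t)).norm.pow_const 2).aestronglyMeasurable
      (ae_of_all _ fun v => by rw [Real.norm_of_nonneg (by positivity)]; exact hb2 t v)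
  have hrep := HasRepLE.of_integral (C := Real.pi * (M * h⁻¹))
    (D := 2 * D ^ 2 * Real.pi * (M * h⁻¹)) ha hb hia2 hib2 (fun s => ?_) (fun t => ?_)
  · convert hrep using 3 with s t
    simp only [sharp, lineAverage, add_smul_axis_one]
    have hcv : ∫ u, K u * g !₂[s, t + h * u] =
        ∫ v, ((h⁻¹ : ℝ) : ℂ) * (K ((v - t) / h) * g !₂[s, v]) := by
      rw [integral_const_mul,
        ← integral_add_right_eq_self (fun v => K ((v - t) / h) * g !₂[s, v]) t]
      have h1 := Measure.integral_comp_div (fun u => K u * g !₂[s, t + h * u]) h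
      rw [abs_of_pos hh] at h1
      have h2 : ∫ v, K ((v + t - t) / h) * g !₂[s, v + t] =
          ∫ v, K (v / h) * g !₂[s, t + h * (v / h)] := by
        refine integral_congr_ae (ae_of_all _ fun v => ?_)
        simp only [add_sub_cancel_left, mul_div_cancel₀ _ hh.ne', add_comm v t]
      rw [h2, h1, Complex.real_smul, ← mul_assoc, ← Complex.ofReal_mul, inv_mul_cancel₀ hh.ne']
      simp
    rw [hcv, ← integral_const_mul]
    refine integral_congr_ae (ae_of_all _ fun v => ?_)
    simp only [a, b]
    have h3 := one_sub_I_mul_ne_zero v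
    conv_lhs => rw [← hrg !₂[s, v]]
    field_simp
  · calc ∫ u, ‖a s u‖ ^ 2 ≤ ∫ u, M * (1 + u ^ 2)⁻¹ :=
          integral_mono (hia2 s) (integrable_inv_one_add_sq.const_mul M) (ha2 s)
      _ = Real.pi * (M * 1) := by
          rw [integral_const_mul, integral_univ_inv_one_add_sq, mul_one, mul_comm]
      -- A deliberate loss: both bounds must be multiples of the same quantity `M * h⁻¹`.
      _ ≤ Real.pi * (M * h⁻¹) := by
          gcongr
          exact (one_le_inv₀ hh).2 hh1
  · calc ∫ v, ‖b t v‖ ^ 2 ≤ ∫ v, (2 * D ^ 2 * M * h⁻¹ ^ 2) * (1 + ((v - t) / h) ^ 2)⁻¹ :=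
          integral_mono (hib2 t) ((hib t).const_mul _) (hb2 t)
      _ = (2 * D ^ 2 * M * h⁻¹ ^ 2) * (h * Real.pi) := by
          rw [integral_const_mul, integral_sub_right_eq_self (fun v => (1 + (v / h) ^ 2)⁻¹) t,
            Measure.integral_comp_div (fun v => (1 + v ^ 2)⁻¹) h, integral_univ_inv_one_add_sq,
            abs_of_pos hh, smul_eq_mul]
      _ = 2 * D ^ 2 * Real.pi * (M * h⁻¹) := by field_simp

end Plane

/-! ### Dilated cutoffs as an approximate identity. -/

section Dilation

variable {V : Type*} [NormedAddCommGroup V] [NormedSpace ℝ V]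

/-- Multiplication by the dilates of a Schwartz function which is one near the origin is an
approximate identity on the Schwartz space. -/
lemma tendsto_smulLeftCLM_dilate (η : 𝓢(V, ℂ)) {r : ℝ} (hr : 0 < r)
    (hη : ∀ x, ‖x‖ ≤ r → η x = 1) (φ : 𝓢(V, ℂ)) :
    Tendsto (fun N : ℕ => SchwartzMap.smulLeftCLM ℂ (fun ξ => η (((2 : ℝ) ^ N)⁻¹ • ξ)) φ) atTop
      (𝓝 φ) := by
  rw [(schwartz_withSeminorms ℝ V ℂ).tendsto_nhds]
  rintro ⟨k, l⟩ ε hε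
  choose A hA hA' using fun i => η.decay 0 i
  set p : ℕ → ℝ := fun i => SchwartzMap.seminorm ℝ (k + 1) i φ
  set B : ℝ := ∑ i ∈ Finset.range (l + 1), (l.choose i : ℝ) * (A i + 1) * p (l - i) with hB
  have hB0 : 0 ≤ B := Finset.sum_nonneg fun i _ => mul_nonneg (mul_nonneg (by positivity)
    (by linarith [hA i])) (apply_nonneg _ _)
  have hlim : Tendsto (fun N : ℕ => B * r⁻¹ * ((1 : ℝ) / 2) ^ N) atTop (𝓝 (B * r⁻¹ * 0)) :=
    (tendsto_pow_atTop_nhds_zero_of_lt_one (by norm_num) (by norm_num)).const_mul _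
  rw [mul_zero] at hlim
  filter_upwards [hlim.eventually (gt_mem_nhds hε)] with N hN
  refine lt_of_le_of_lt ?_ hN
  have h2 : (0 : ℝ) < 2 ^ N := by positivity
  have hgrowth : (fun ξ => η (((2 : ℝ) ^ N)⁻¹ • ξ)).HasTemperateGrowth :=
    η.hasTemperateGrowth.comp (((2 : ℝ) ^ N)⁻¹ • ContinuousLinearMap.id ℝ V).hasTemperateGrowth
  refine SchwartzMap.seminorm_le_bound ℝ k l _ (by positivity) fun x => ?_
  set μ : V → ℂ := fun ξ => η (((2 : ℝ) ^ N)⁻¹ • ξ) - 1 with hμ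
  have hfun : ((SchwartzMap.smulLeftCLM ℂ (fun ξ => η (((2 : ℝ) ^ N)⁻¹ • ξ)) φ - φ : 𝓢(V, ℂ)) :
      V → ℂ) = fun ξ => μ ξ * φ ξ := by
    ext ξ
    simp only [_root_.sub_apply, SchwartzMap.smulLeftCLM_apply_apply hgrowth, hμ, smul_eq_mul]
    ring
  rw [hfun]
  have hηs : ContDiff ℝ l η := η.smooth l
  have hdil : ContDiff ℝ l fun ξ => η (((2 : ℝ) ^ N)⁻¹ • ξ) := by fun_prop
  have hμs : ContDiff ℝ l μ := hdil.sub contDiff_const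
  -- On the ball of radius `2 ^ N * r` the factor `μ` vanishes identically. Outside, one extra power
  -- of `‖x‖` from the seminorms of order `k + 1` supplies the decay `2⁻ᴺ`.
  rcases lt_or_ge ‖x‖ (2 ^ N * r) with hx | hx
  · have h0 : (fun ξ => μ ξ * φ ξ) =ᶠ[𝓝 x] fun _ => 0 := by
      filter_upwards [(isOpen_lt continuous_norm continuous_const).mem_nhds hx] with ξ hξ
      have : ‖((2 : ℝ) ^ N)⁻¹ • ξ‖ ≤ r := by
        rw [norm_smul, norm_inv, Real.norm_of_nonneg h2.le, inv_mul_le_iff₀ h2]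
        exact le_of_lt hξ
      simp [hμ, hη _ this]
    rw [(h0.iteratedFDeriv ℝ l).eq_of_nhds]
    simp only [iteratedFDeriv_fun_zero, Pi.zero_apply, norm_zero, mul_zero]
    positivity
  · have hx0 : 0 < ‖x‖ := lt_of_lt_of_le (by positivity) hx
    have hμb : ∀ i ≤ l, ‖iteratedFDeriv ℝ i μ x‖ ≤ A i + 1 := by
      intro i hi
      have hηi : ContDiff ℝ i η := η.smooth i
      have hdi : ContDiff ℝ i fun ξ => η (((2 : ℝ) ^ N)⁻¹ • ξ) := by fun_prop
      have h1 : iteratedFDeriv ℝ i μ x = iteratedFDeriv ℝ i (fun ξ => η (((2 : ℝ) ^ N)⁻¹ • ξ)) x -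
          iteratedFDeriv ℝ i (fun _ => (1 : ℂ)) x :=
        iteratedFDeriv_sub_apply hdi.contDiffAt contDiff_const.contDiffAt
      rw [h1]
      refine norm_sub_le_of_le ?_ ?_
      · rw [iteratedFDeriv_comp_const_smul _ hηi, norm_smul, norm_pow, norm_inv,
          Real.norm_of_nonneg h2.le]
        have h3 := hA' i (((2 : ℝ) ^ N)⁻¹ • x)
        rw [pow_zero, one_mul] at h3
        refine (mul_le_of_le_one_left (norm_nonneg _) (pow_le_one₀ (by positivity) ?_)).trans h3
        exact inv_le_one_of_one_le₀ (one_le_pow₀ (by norm_num))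
      · rcases Nat.eq_zero_or_pos i with rfl | hi'
        · simp
        · rw [iteratedFDeriv_const_of_ne hi'.ne']
          simp
    calc ‖x‖ ^ k * ‖iteratedFDeriv ℝ l (fun ξ => μ ξ * φ ξ) x‖
        ≤ ‖x‖ ^ k * ∑ i ∈ Finset.range (l + 1), (l.choose i : ℝ) * ‖iteratedFDeriv ℝ i μ x‖ *
          ‖iteratedFDeriv ℝ (l - i) φ x‖ := by
          gcongr
          exact norm_iteratedFDeriv_mul_le hμs (φ.smooth l) x le_rfl
      _ ≤ ‖x‖ ^ k * ∑ i ∈ Finset.range (l + 1), (l.choose i : ℝ) * (A i + 1) *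
          (p (l - i) / ‖x‖ ^ (k + 1)) := by
          gcongr with i hi
          · exact mul_nonneg (by positivity) (by linarith [hA i])
          · exact hμb i (Nat.lt_succ_iff.1 (Finset.mem_range.1 hi))
          · rw [le_div_iff₀ (by positivity), mul_comm]
            exact SchwartzMap.le_seminorm ℝ _ _ _ _
      _ = B * ‖x‖⁻¹ := by
          rw [hB, Finset.mul_sum, Finset.sum_mul]
          refine Finset.sum_congr rfl fun i _ => ?_
          rw [pow_succ]
          field_simp
      _ ≤ B * (2 ^ N * r)⁻¹ := by gcongr
      _ = B * r⁻¹ * (1 / 2) ^ N := by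
          rw [mul_inv, one_div, inv_pow]
          ring

end Dilation

/-! ### The dyadic resolution of unity and the Littlewood–Paley decomposition. -/

namespace IsDyadicBump

variable {w : ℝ → ℝ} (hw : IsDyadicBump w)

include hw

lemma eq_zero_of_lt {t : ℝ} (ht : t < 1 / 2) : w t = 0 :=
  image_eq_zero_of_notMem_tsupport fun h => absurd (hw.support_subset h).1 (not_le.2 ht)

lemma eq_zero_of_gt {t : ℝ} (ht : 2 < t) : w t = 0 :=
  image_eq_zero_of_notMem_tsupport fun h => absurd (hw.support_subset h).2 (not_le.2 ht)

/-- The endpoint `1 / 2`, which the support condition leaves open, is settled by continuity. -/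
lemma eq_zero_of_le {t : ℝ} (ht : t ≤ 1 / 2) : w t = 0 := by
  have h : closure (Iio (1 / 2 : ℝ)) ⊆ {t | w t = 0} :=
    closure_minimal (fun _ h => hw.eq_zero_of_lt h)
      (isClosed_eq hw.smooth.continuous continuous_const)
  rw [closure_Iio] at h
  exact h ht

end IsDyadicBump

/-- The radial profile of the low frequency symbol. -/
def lowProfile (w : ℝ → ℝ) (r : ℝ) : ℝ := if r ≤ 1 then 1 else w r

section Symbols

variable {w : ℝ → ℝ} (hw : IsDyadicBump w)

include hw

/-- The identity `w(r) + w(r / 2) = 1` on `[1, 2]` in telescoping form; partial sums of the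
resolution of unity become dilates of the low profile. -/
lemma lowProfile_add (r : ℝ) : lowProfile w r + w (r / 2) = lowProfile w (r / 2) := by
  unfold lowProfile
  rcases le_or_gt r 1 with h1 | h1
  · rw [if_pos h1, if_pos (by linarith), hw.eq_zero_of_le (by linarith), add_zero]
  · rw [if_neg (not_le.2 h1)]
    rcases le_or_gt r 2 with h2 | h2
    · rw [if_pos (by linarith), hw.eq_one_sub r ⟨h1.le, h2⟩]
      ring
    · rw [if_neg (by linarith), hw.eq_zero_of_gt h2, zero_add]

lemma sum_bump (r : ℝ) (N : ℕ) :
    ∑ n ∈ Finset.range N, w (r / 2 ^ (n + 1)) = lowProfile w (r / 2 ^ N) - lowProfile w r := by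
  induction N with
  | zero => simp
  | succ N ih =>
    have h := lowProfile_add hw (r / 2 ^ N)
    rw [div_div, ← pow_succ] at h
    rw [Finset.sum_range_succ, ih]
    linarith

lemma lowSymbol_eq (t : Plane) : lowSymbol w t = lowProfile w ‖t‖ := by
  have h1 : HasSum (fun n : ℕ => blockSymbol w (n + 1) t) (1 - lowProfile w ‖t‖) := by
    rw [hasSum_iff_tendsto_nat_of_nonneg (f := fun n : ℕ => blockSymbol w (n + 1) t)
      fun n => hw.nonneg _]
    have hlim : Tendsto (fun N : ℕ => ‖t‖ / 2 ^ N) atTop (𝓝 0) := by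
      have := (tendsto_pow_atTop_nhds_zero_of_lt_one (r := (1 : ℝ) / 2) (by norm_num)
        (by norm_num)).const_mul ‖t‖
      simpa [div_eq_mul_inv] using this
    refine tendsto_const_nhds.congr' ?_
    filter_upwards [hlim.eventually (gt_mem_nhds one_pos)] with N hN
    have h2 := sum_bump hw ‖t‖ N
    simp only [blockSymbol]
    rw [h2]
    simp only [lowProfile]
    rw [if_pos hN.le]
  rw [lowSymbol, h1.tsum_eq]
  ring

lemma contDiff_blockSymbol (n : ℕ) : ContDiff ℝ (⊤ : ℕ∞) (blockSymbol w n) := by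
  rw [contDiff_iff_contDiffAt]
  intro t
  by_cases ht : t = 0
  · subst ht
    have h0 : blockSymbol w n =ᶠ[𝓝 0] fun _ => 0 := by
      have hc : Continuous fun t : Plane => ‖t‖ / 2 ^ n := by fun_prop
      have h1 : ∀ᶠ t in 𝓝 (0 : Plane), ‖t‖ / 2 ^ n < 1 / 2 :=
        (hc.tendsto 0).eventually (gt_mem_nhds (by simp))
      exact h1.mono fun t ht => hw.eq_zero_of_lt ht
    exact contDiffAt_const.congr_of_eventuallyEq h0
  · exact hw.smooth.contDiffAt.comp t ((contDiffAt_norm ℝ ht).div_const _)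

/-- The two formulas for the symbol, valid for `‖t‖ < 2` and for `‖t‖ > 1`, overlap, so the break in
`lowProfile` at `1` does no harm. -/
lemma contDiff_lowSymbol : ContDiff ℝ (⊤ : ℕ∞) (lowSymbol w) := by
  rw [contDiff_iff_contDiffAt]
  intro t
  have hn : Continuous fun t : Plane => ‖t‖ := continuous_norm
  rcases lt_or_ge ‖t‖ 2 with ht | ht
  · have h1 : lowSymbol w =ᶠ[𝓝 t] fun t => 1 - blockSymbol w 1 t := by
      filter_upwards [(hn.tendsto t).eventually (gt_mem_nhds ht)] with x hx
      have h2 := lowProfile_add hw ‖x‖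
      have h3 : lowProfile w (‖x‖ / 2) = 1 := if_pos (by linarith)
      rw [lowSymbol_eq hw, blockSymbol, pow_one]
      linarith
    exact (contDiffAt_const.sub (contDiff_blockSymbol hw 1).contDiffAt).congr_of_eventuallyEq h1
  · have h1 : lowSymbol w =ᶠ[𝓝 t] fun t => blockSymbol w 0 t := by
      filter_upwards [(hn.tendsto t).eventually (lt_mem_nhds (show (1 : ℝ) < ‖t‖ by linarith))]
        with x hx
      rw [lowSymbol_eq hw, lowProfile, if_neg (not_le.2 hx), blockSymbol, pow_zero, div_one]
    exact (contDiff_blockSymbol hw 0).contDiffAt.congr_of_eventuallyEq h1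

end Symbols

/-- The symbols of the dyadic resolution of unity; the first one is the low frequency symbol. -/
def dyadicSymbol (w : ℝ → ℝ) : ℕ → Plane → ℝ
  | 0 => lowSymbol w
  | n + 1 => blockSymbol w (n + 1)

/-- The symbols of the dyadic resolution of unity in the variable of Mathlib's Fourier
transform. -/
def dyadicMultiplier (w : ℝ → ℝ) (n : ℕ) (ξ : Plane) : ℂ :=
  ((dyadicSymbol w n ((2 * Real.pi) • ξ) : ℝ) : ℂ)

section Symbols

variable {w : ℝ → ℝ} (hw : IsDyadicBump w)

include hw

lemma contDiff_dyadicSymbol : ∀ n, ContDiff ℝ (⊤ : ℕ∞) (dyadicSymbol w n)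
  | 0 => contDiff_lowSymbol hw
  | n + 1 => contDiff_blockSymbol hw (n + 1)

lemma dyadicSymbol_eq_zero {n : ℕ} {t : Plane} (ht : 2 ^ (n + 1) < ‖t‖) :
    dyadicSymbol w n t = 0 := by
  cases n with
  | zero =>
    rw [zero_add, pow_one] at ht
    rw [dyadicSymbol, lowSymbol_eq hw, lowProfile, if_neg (by linarith), hw.eq_zero_of_gt ht]
  | succ n =>
    refine hw.eq_zero_of_gt ?_
    rw [lt_div_iff₀ (by positivity), ← pow_succ']
    exact ht

lemma sum_dyadicSymbol (N : ℕ) (t : Plane) :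
    ∑ n ∈ Finset.range (N + 1), dyadicSymbol w n t = lowSymbol w (((2 : ℝ) ^ N)⁻¹ • t) := by
  rw [Finset.sum_range_succ', lowSymbol_eq hw, norm_smul, norm_inv, norm_pow,
    Real.norm_of_nonneg zero_le_two, inv_mul_eq_div]
  have h := sum_bump hw ‖t‖ N
  simp only [dyadicSymbol, blockSymbol, lowSymbol_eq hw]
  linarith

lemma dyadicMultiplier_eq_zero {n : ℕ} {ξ : Plane} (h : 2 ^ n < ‖ξ‖) :
    dyadicMultiplier w n ξ = 0 := by
  rw [dyadicMultiplier, dyadicSymbol_eq_zero hw, Complex.ofReal_zero]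
  rw [norm_smul, Real.norm_of_nonneg (by positivity), pow_succ']
  -- The factor `2 * π ≥ 2` between the two frequency variables turns the radius `2 ^ (n + 1)` into
  -- `2 ^ n`.
  have := Real.pi_gt_three
  have h2 : (0 : ℝ) < 2 ^ n := by positivity
  nlinarith

lemma contDiff_dyadicMultiplier (n : ℕ) : ContDiff ℝ (⊤ : ℕ∞) (dyadicMultiplier w n) :=
  Complex.ofRealCLM.contDiff.comp ((contDiff_dyadicSymbol hw n).comp (contDiff_const_smul _))

lemma hasCompactSupport_dyadicMultiplier (n : ℕ) : HasCompactSupport (dyadicMultiplier w n) := by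
  refine HasCompactSupport.intro (isCompact_closedBall (0 : Plane) (2 ^ n)) fun ξ hξ => ?_
  rw [mem_closedBall_zero_iff, not_le] at hξ
  exact dyadicMultiplier_eq_zero hw hξ

lemma hasTemperateGrowth_dyadicMultiplier (n : ℕ) : (dyadicMultiplier w n).HasTemperateGrowth :=
  ((hasCompactSupport_dyadicMultiplier hw n).toSchwartzMap
    (contDiff_dyadicMultiplier hw n)).hasTemperateGrowth

/-- The Littlewood–Paley decomposition of a tempered distribution. -/
lemma tendsto_sum_convWithSymbol (T : 𝓢'(Plane, ℂ)) (φ : 𝓢(Plane, ℂ)) :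
    Tendsto (fun N => ∑ n ∈ Finset.range (N + 1), convWithSymbol (dyadicSymbol w n) T φ) atTop
      (𝓝 (T φ)) := by
  let η : 𝓢(Plane, ℂ) := (hasCompactSupport_dyadicMultiplier hw 0).toSchwartzMap
    (contDiff_dyadicMultiplier hw 0)
  have hη : ∀ ξ, ‖ξ‖ ≤ (2 * Real.pi)⁻¹ → η ξ = 1 := by
    intro ξ hξ
    change dyadicMultiplier w 0 ξ = 1
    rw [dyadicMultiplier, dyadicSymbol, lowSymbol_eq hw, lowProfile, if_pos, Complex.ofReal_one]
    rw [norm_smul, Real.norm_of_nonneg (by positivity)]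
    rwa [← le_inv_mul_iff₀ (by positivity), mul_one]
  have h1 := tendsto_smulLeftCLM_dilate η (by positivity) hη (𝓕⁻ φ)
  have h2 : Continuous fun ψ : 𝓢(Plane, ℂ) => T (𝓕 ψ) := by
    have := (FourierTransform.fourierCLM ℂ 𝓢(Plane, ℂ)).continuous
    exact (map_continuous T).comp this
  have h3 := (h2.tendsto (𝓕⁻ φ)).comp h1
  rw [fourier_fourierInv_eq] at h3
  refine h3.congr fun N => ?_
  -- By telescoping, the partial sum up to `N` is the low frequency cutoff dilated by `2 ^ N`.
  have h4 : (fun ξ => η (((2 : ℝ) ^ N)⁻¹ • ξ)) =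
      fun ξ => ∑ n ∈ Finset.range (N + 1), dyadicMultiplier w n ξ := by
    ext ξ
    change dyadicMultiplier w 0 _ = _
    simp only [dyadicMultiplier, ← Complex.ofReal_sum, sum_dyadicSymbol hw]
    rw [smul_comm, dyadicSymbol]
  rw [Function.comp_apply, h4,
    SchwartzMap.smulLeftCLM_sum fun n _ => hasTemperateGrowth_dyadicMultiplier hw n]
  rw [_root_.sum_apply, FourierTransform.fourier_sum, map_sum]
  rfl

end Symbols

/-! ### Blocks of a Besov distribution and their sum. -/

lemma linftyNorm_eq {S : 𝓢'(Plane, ℂ)} {g : Lp ℂ ∞ (volume : Measure Plane)}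
    (hg : Lp.toTemperedDistribution g = S) : linftyNorm S = ‖g‖ₑ := by
  have hinj : Function.Injective
      (Lp.toTemperedDistributionCLM ℂ (volume : Measure Plane) (∞ : ℝ≥0∞)) :=
    LinearMap.ker_eq_bot.1 Lp.ker_toTemperedDistributionCLM_eq_bot
  refine le_antisymm (iInf₂_le g hg) (le_iInf₂ fun g' hg' => ?_)
  rw [hinj (hg'.trans hg.symm)]

lemma exists_bounded_density {S : 𝓢'(Plane, ℂ)} (hS : linftyNorm S < ∞) :
    ∃ g : Plane → ℂ, Measurable g ∧ (∀ x, ‖g x‖ ≤ (linftyNorm S).toReal) ∧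
      ∀ φ : 𝓢(Plane, ℂ), S φ = ∫ x, φ x * g x := by
  obtain ⟨g, hg⟩ : ∃ g : Lp ℂ ∞ (volume : Measure Plane), Lp.toTemperedDistribution g = S := by
    by_contra! h
    refine hS.ne ?_
    simp [linftyNorm, h]
  rw [linftyNorm_eq hg, toReal_enorm]
  have hm : Measurable g := (Lp.stronglyMeasurable g).measurable
  have hs : MeasurableSet {x | ‖g x‖ ≤ ‖g‖} := measurableSet_le hm.norm measurable_const
  have hae : ∀ᵐ x, ‖g x‖ ≤ ‖g‖ := by
    have h1 : ∀ᵐ x, ‖g x‖ₑ ≤ eLpNorm g ∞ volume := by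
      rw [eLpNorm_exponent_top]
      exact ae_le_eLpNormEssSup
    filter_upwards [h1] with x hx
    rw [← toReal_enorm (g x), Lp.norm_def]
    exact ENNReal.toReal_mono (Lp.eLpNorm_ne_top g) hx
  -- The density is set to zero where the essential bound fails: integrals over lines, which are
  -- null sets, need the bound at every point.
  refine ⟨{x | ‖g x‖ ≤ ‖g‖}.indicator g, hm.indicator hs, fun x => ?_, fun φ => ?_⟩
  · by_cases hx : ‖g x‖ ≤ ‖g‖
    · rwa [indicator_of_mem (by exact hx)]
    · rw [indicator_of_notMem (by exact hx), norm_zero]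
      exact norm_nonneg g
  · rw [← hg, Lp.toTemperedDistribution_apply]
    refine integral_congr_ae (hae.mono fun x hx => ?_)
    simp only [indicator_of_mem (show x ∈ {x | ‖g x‖ ≤ ‖g‖} from hx), smul_eq_mul]

/-- A smooth cutoff function on the line which is one on `[-1, 1]`. -/
lemma exists_cutoff : ∃ k : 𝓢(ℝ, ℂ), ∀ τ, |τ| ≤ 1 → k τ = 1 := by
  let b : ContDiffBump (0 : ℝ) := ⟨1, 2, one_pos, one_lt_two⟩
  have h1 : HasCompactSupport fun τ => ((b τ : ℝ) : ℂ) :=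
    b.hasCompactSupport.comp_left (g := ((↑) : ℝ → ℂ)) Complex.ofReal_zero
  have h2 : ContDiff ℝ (⊤ : ℕ∞) fun τ => ((b τ : ℝ) : ℂ) :=
    Complex.ofRealCLM.contDiff.comp b.contDiff
  refine ⟨h1.toSchwartzMap h2, fun τ hτ => ?_⟩
  change ((b τ : ℝ) : ℂ) = 1
  rw [b.one_of_mem_closedBall (by simpa [Real.norm_eq_abs] using hτ), Complex.ofReal_one]

lemma fourierMultiplierCLM_apply_eq_integral_lineAverage (k : 𝓢(ℝ, ℂ)) (v : Plane) {g : Plane → ℂ}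
    {M : ℝ} (hg : Measurable g) (hM : ∀ x, ‖g x‖ ≤ M) {S : 𝓢'(Plane, ℂ)}
    (hS : ∀ φ : 𝓢(Plane, ℂ), S φ = ∫ x, φ x * g x) (φ : 𝓢(Plane, ℂ)) :
    TemperedDistribution.fourierMultiplierCLM ℂ (fun ξ : Plane => k (inner ℝ v ξ)) S φ =
      ∫ x, φ x * lineAverage (𝓕 k : 𝓢(ℝ, ℂ)) v g x := by
  rw [TemperedDistribution.fourierMultiplierCLM_apply_apply, hS,
    ← integral_mul_lineAverage (𝓕 k).continuous (𝓕 k).integrable hg hM]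
  simp only [fourier_smulLeftCLM_fourierInv]

section Besov

lemma besovNorm_eq_tsum (w : ℝ → ℝ) (T : 𝓢'(Plane, ℂ)) :
    besovNorm w T = ∑' n, 2 ^ n * linftyNorm (convWithSymbol (dyadicSymbol w n) T) := by
  rw [tsum_eq_zero_add' ENNReal.summable, pow_zero, one_mul]
  rfl

variable {w : ℝ → ℝ} (hw : IsDyadicBump w)

include hw

/-- On the support of the `n`-th multiplier `|2⁻ⁿ ξ_j| ≤ 1`, where `k` is one. -/
lemma fourierMultiplierCLM_convWithSymbol {k : 𝓢(ℝ, ℂ)} (hk : ∀ τ, |τ| ≤ 1 → k τ = 1) (n : ℕ)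
    (j : Fin 2) (T : 𝓢'(Plane, ℂ)) :
    TemperedDistribution.fourierMultiplierCLM ℂ
      (fun ξ : Plane => k (inner ℝ (axis ((2 : ℝ) ^ n)⁻¹ j) ξ))
      (convWithSymbol (dyadicSymbol w n) T) = convWithSymbol (dyadicSymbol w n) T := by
  have hkg : (fun ξ : Plane => k (inner ℝ (axis ((2 : ℝ) ^ n)⁻¹ j) ξ)).HasTemperateGrowth :=
    k.hasTemperateGrowth.comp (innerSL ℝ _).hasTemperateGrowth
  have h1 : (dyadicMultiplier w n) * (fun ξ : Plane => k (inner ℝ (axis ((2 : ℝ) ^ n)⁻¹ j) ξ)) =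
      dyadicMultiplier w n := by
    ext ξ
    rw [Pi.mul_apply]
    rcases lt_or_ge (2 ^ n) ‖ξ‖ with h | h
    · rw [dyadicMultiplier_eq_zero hw h, zero_mul]
    · rw [hk, mul_one]
      refine (abs_real_inner_le_norm _ _).trans ?_
      rw [axis, PiLp.norm_single, norm_inv, norm_pow, Real.norm_of_nonneg zero_le_two,
        inv_mul_le_iff₀ (by positivity), mul_one]
      exact h
  change TemperedDistribution.fourierMultiplierCLM ℂ _
    (TemperedDistribution.fourierMultiplierCLM ℂ (dyadicMultiplier w n) T) =
      TemperedDistribution.fourierMultiplierCLM ℂ (dyadicMultiplier w n) T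
  rw [TemperedDistribution.fourierMultiplierCLM_fourierMultiplierCLM_apply
    (hasTemperateGrowth_dyadicMultiplier hw n) hkg, h1]

/-- Averaging a bounded density along both axes leaves the distribution unchanged and yields its
continuous representative. The average along the second axis is also the one that gives the Haagerup
representation, with `h⁻¹ = 2 ^ n`. -/
lemma exists_continuous_block {k : 𝓢(ℝ, ℂ)} (hk : ∀ τ, |τ| ≤ 1 → k τ = 1) {D : ℝ}
    (hD : ∀ u, ‖𝓕 k u‖ ≤ D * (1 + u ^ 2)⁻¹) (n : ℕ) {T : 𝓢'(Plane, ℂ)}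
    (hT : linftyNorm (convWithSymbol (dyadicSymbol w n) T) < ∞) :
    ∃ f : Plane →ᵇ ℂ, IsInducedBy (convWithSymbol (dyadicSymbol w n) T) f ∧
      ‖f‖ ≤ (D * Real.pi) ^ 2 * (linftyNorm (convWithSymbol (dyadicSymbol w n) T)).toReal ∧
      HasRepLE (sharp f)
        (D * Real.pi ^ 2 *
          (2 ^ n * (linftyNorm (convWithSymbol (dyadicSymbol w n) T)).toReal))
        (2 * D ^ 3 * Real.pi ^ 2 *
          (2 ^ n * (linftyNorm (convWithSymbol (dyadicSymbol w n) T)).toReal)) := by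
  obtain ⟨g, hg, hM, hS⟩ := exists_bounded_density hT
  set S := convWithSymbol (dyadicSymbol w n) T with hSdef
  set M := (linftyNorm S).toReal
  have hM0 : 0 ≤ M := ENNReal.toReal_nonneg
  set h : ℝ := ((2 : ℝ) ^ n)⁻¹ with hh
  have hh0 : 0 < h := by positivity
  have hh1 : h ≤ 1 := inv_le_one_of_one_le₀ (one_le_pow₀ one_le_two)
  have hK := (𝓕 k).continuous
  have hKi := integrable_of_decay hK hD
  have hKn := integral_norm_le_of_decay hK hD
  have hD0 : 0 ≤ D := by simpa using (norm_nonneg _).trans (hD 0)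
  set g₁ := lineAverage (𝓕 k : 𝓢(ℝ, ℂ)) (axis h 0) g
  set g₂ := lineAverage (𝓕 k : 𝓢(ℝ, ℂ)) (axis h 1) g₁
  have hm₁ : Measurable g₁ := measurable_lineAverage hK hg _
  have hb₁ : ∀ x, ‖g₁ x‖ ≤ D * Real.pi * M := fun x =>
    (norm_lineAverage_le hKi hM _ x).trans (by gcongr)
  have hb₂ : ∀ x, ‖g₂ x‖ ≤ (D * Real.pi) ^ 2 * M := fun x =>
    (norm_lineAverage_le hKi hb₁ _ x).trans
      ((mul_le_mul_of_nonneg_right hKn (by positivity)).trans (by rw [pow_two, ← mul_assoc]))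
  have hS₁ : ∀ φ : 𝓢(Plane, ℂ), S φ = ∫ x, φ x * g₁ x := fun φ => by
    rw [← fourierMultiplierCLM_apply_eq_integral_lineAverage k _ hg hM hS,
      hSdef, fourierMultiplierCLM_convWithSymbol hw hk n 0 T]
  have hS₂ : ∀ φ : 𝓢(Plane, ℂ), S φ = ∫ x, φ x * g₂ x := fun φ => by
    rw [← fourierMultiplierCLM_apply_eq_integral_lineAverage k _ hm₁ hb₁ hS₁,
      hSdef, fourierMultiplierCLM_convWithSymbol hw hk n 1 T]
  refine ⟨BoundedContinuousFunction.ofNormedAddCommGroup g₂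
    (continuous_lineAverage_lineAverage hK hD hg hM hh0.ne') _ hb₂, hS₂,
    BoundedContinuousFunction.norm_ofNormedAddCommGroup_le _ (by positivity) hb₂, ?_⟩
  have hrep := hasRepLE_sharp_lineAverage hK hD hm₁ hb₁ hh0 hh1
  have e₁ : Real.pi * (D * Real.pi * M * h⁻¹) = D * Real.pi ^ 2 * (2 ^ n * M) := by
    rw [hh, inv_inv]
    ring
  have e₂ : 2 * D ^ 2 * Real.pi * (D * Real.pi * M * h⁻¹) =
      2 * D ^ 3 * Real.pi ^ 2 * (2 ^ n * M) := by
    rw [hh, inv_inv]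
    ring
  rw [e₁, e₂] at hrep
  exact hrep

/-- A distribution of the Besov space is induced by a bounded continuous function, the quotient of
which by `1 - i t` has a representation as in the Haagerup tensor product. -/
lemma MemBesov.exists_isInducedBy {k : 𝓢(ℝ, ℂ)} (hk : ∀ τ, |τ| ≤ 1 → k τ = 1) {D : ℝ}
    (hD : ∀ u, ‖𝓕 k u‖ ≤ D * (1 + u ^ 2)⁻¹) {T : 𝓢'(Plane, ℂ)} (hT : MemBesov w T) :
    ∃ f : Plane →ᵇ ℂ, IsInducedBy T f ∧
      HasRepLE (sharp f) (D * Real.pi ^ 2 * (besovNorm w T).toReal)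
        (2 * D ^ 3 * Real.pi ^ 2 * (besovNorm w T).toReal) := by
  set L : ℕ → ℝ≥0∞ := fun n => linftyNorm (convWithSymbol (dyadicSymbol w n) T) with hL
  have hsum : ∑' n, 2 ^ n * L n ≠ ∞ := by
    rw [← besovNorm_eq_tsum w]
    exact hT.ne
  have hterm : ∀ n, 2 ^ n * L n ≠ ∞ := fun n => ENNReal.ne_top_of_tsum_ne_top hsum n
  have hLfin : ∀ n, L n < ∞ := fun n => by
    refine lt_of_le_of_lt ?_ (hterm n).lt_top
    exact le_mul_of_one_le_left' (one_le_pow₀ (by norm_num))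
  choose F hF hFn hFr using fun n => exists_continuous_block hw hk hD n (hLfin n)
  set c : ℕ → ℝ := fun n => 2 ^ n * (L n).toReal with hc
  have hcr : ∀ n, (2 ^ n * L n).toReal = c n := fun n => by simp [hc]
  have hcs : Summable c := (ENNReal.summable_toReal hsum).congr hcr
  have hct : ∑' n, c n = (besovNorm w T).toReal := by
    rw [besovNorm_eq_tsum w, ENNReal.tsum_toReal_eq hterm]
    exact (tsum_congr hcr).symm
  -- Since `2 ^ n ≥ 1`, the sup norms of the blocks are dominated by the Besov terms, so the blocks
  -- sum uniformly.
  have hFs : Summable F := by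
    refine Summable.of_norm_bounded (hcs.mul_left ((D * Real.pi) ^ 2)) fun n => ?_
    refine (hFn n).trans ?_
    gcongr
    exact le_mul_of_one_le_left ENNReal.toReal_nonneg (one_le_pow₀ one_le_two)
  have hpt : ∀ x, HasSum (fun n => F n x) ((∑' n, F n) x) := fun x =>
    hFs.hasSum.mapL (BoundedContinuousFunction.evalCLM ℂ x)
  refine ⟨∑' n, F n, fun φ => ?_, ?_⟩
  · have h1 := tendsto_sum_convWithSymbol hw T φ
    have h2 : ∀ N, ∑ n ∈ Finset.range (N + 1), convWithSymbol (dyadicSymbol w n) T φ =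
        ∫ x, φ x * (∑ n ∈ Finset.range (N + 1), F n) x := by
      intro N
      simp only [hF _ φ]
      rw [← integral_finsetSum]
      · refine integral_congr_ae (ae_of_all _ fun x => ?_)
        simp only [BoundedContinuousFunction.coe_sum, Finset.sum_apply, Finset.mul_sum]
      · exact fun n _ => φ.integrable.mul_bdd (F n).continuous.aestronglyMeasurable
          (ae_of_all _ fun x => (F n).norm_coe_le_norm x)
    have h3 : Tendsto (fun N => ∫ x, φ x * (∑ n ∈ Finset.range (N + 1), F n) x) atTop
        (𝓝 (∫ x, φ x * (∑' n, F n) x)) := by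
      have hbd : ∀ N, ‖∑ n ∈ Finset.range (N + 1), F n‖ ≤ ∑' n, (D * Real.pi) ^ 2 * c n := by
        intro N
        have h0 : ∀ n, ‖F n‖ ≤ (D * Real.pi) ^ 2 * c n := fun n => by
          refine (hFn n).trans ?_
          gcongr
          exact le_mul_of_one_le_left ENNReal.toReal_nonneg (one_le_pow₀ one_le_two)
        exact (norm_sum_le_of_le _ fun n _ => h0 n).trans
          ((hcs.mul_left _).sum_le_tsum _ fun n _ => (norm_nonneg _).trans (h0 n))
      refine tendsto_integral_of_dominated_convergence
        (fun x => ‖φ x‖ * ∑' n, (D * Real.pi) ^ 2 * c n)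
        (fun N => (φ.continuous.mul (BoundedContinuousFunction.continuous _)).aestronglyMeasurable)
        (φ.integrable.norm.mul_const _) (fun N => ae_of_all _ fun x => ?_)
        (ae_of_all _ fun x => ?_)
      · rw [norm_mul]
        gcongr
        exact (BoundedContinuousFunction.norm_coe_le_norm _ x).trans (hbd N)
      · refine Tendsto.const_mul _ ?_
        have h4 := ((hpt x).tendsto_sum_nat).comp (tendsto_add_atTop_nat 1)
        refine h4.congr fun N => ?_
        simp [BoundedContinuousFunction.coe_sum]
    simp only [h2] at h1
    exact tendsto_nhds_unique h1 h3
  · rw [← hct]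
    exact HasRepLE.hasSum hcs hFr fun s t => (hpt !₂[s, t]).mul_left _

end Besov

lemma IsInducedBy.unique {T : 𝓢'(Plane, ℂ)} {f f' : Plane →ᵇ ℂ} (h : IsInducedBy T f)
    (h' : IsInducedBy T f') : f = f' := by
  have hloc : ∀ f : Plane →ᵇ ℂ, LocallyIntegrable f (volume : Measure Plane) := fun f =>
    f.continuous.locallyIntegrable
  have h1 : (f : Plane → ℂ) =ᵐ[volume] f' := by
    refine ae_eq_of_integral_contDiff_smul_eq (hloc f) (hloc f') fun g hg hgc => ?_
    have h1 : HasCompactSupport fun x => ((g x : ℝ) : ℂ) :=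
      hgc.comp_left (g := ((↑) : ℝ → ℂ)) Complex.ofReal_zero
    have h2 : ContDiff ℝ (⊤ : ℕ∞) fun x => ((g x : ℝ) : ℂ) := Complex.ofRealCLM.contDiff.comp hg
    have h3 := (h (h1.toSchwartzMap h2)).symm.trans (h' (h1.toSchwartzMap h2))
    simpa using h3
  exact DFunLike.coe_injective ((f.continuous.ae_eq_iff_eq _ f'.continuous).1 h1)

end PairFunctions

end

open PairFunctions
theorem theorem4p1 :
    ∃ C : ℝ≥0, ∀ w : ℝ → ℝ, IsDyadicBump w →
      ∀ T : 𝓢'(Plane, ℂ), MemBesov w T →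
        (∃! f : Plane →ᵇ ℂ, IsInducedBy T f) ∧
        ∀ f : Plane →ᵇ ℂ, IsInducedBy T f →
          MemHaagerup (sharp f) ∧
          haagerupNorm (sharp f) ≤ C * besovNorm w T ∧
          ∀ (H : Type*) [NormedAddCommGroup H] [InnerProductSpace ℂ H] [CompleteSpace H]
            (A B : H →ₗ.[ℂ] H), IsSelfAdjoint A → IsSelfAdjoint B →
            ∀ EA EB : SpectralMeasure H,
              EA.IsSpectralMeasureOf A → EB.IsSpectralMeasureOf B →
              ∃! F : H →ₗ.[ℂ] H, IsFunctionOfPair EA EB B f F := by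

  obtain ⟨k, hk⟩ := exists_cutoff
  obtain ⟨D, hD0, hD⟩ := exists_decay (FourierTransform.fourier k)
  have hC : 0 ≤ D * Real.pi ^ 2 + 2 * D ^ 3 * Real.pi ^ 2 := by positivity
  -- The norm estimate is the geometric mean of the two square-sum bounds, which the sum of their
  -- constants dominates; `D` comes from `k` alone.
  refine ⟨(D * Real.pi ^ 2 + 2 * D ^ 3 * Real.pi ^ 2).toNNReal, fun w hw T hT => ?_⟩
  obtain ⟨f₀, hf₀, hrep⟩ := hT.exists_isInducedBy hw hk hD
  refine ⟨⟨f₀, hf₀, fun f hf => hf.unique hf₀⟩, fun f hf => ?_⟩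
  obtain rfl := hf.unique hf₀
  refine ⟨hrep.memHaagerup, hrep.haagerupNorm_le.trans ?_, fun H _ _ _ A B _ _ EA EB _ _ =>
    existsUnique_isFunctionOfPair hrep.memHaagerup B⟩
  set b := (besovNorm w T).toReal with hb
  have hb0 : 0 ≤ b := ENNReal.toReal_nonneg
  have h1 : besovNorm w T = ENNReal.ofReal b := (ENNReal.ofReal_toReal hT.ne).symm
  set C := D * Real.pi ^ 2 + 2 * D ^ 3 * Real.pi ^ 2 with hCdef
  have h2 : ((C.toNNReal : ℝ≥0) : ℝ≥0∞) = ENNReal.ofReal C := rfl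
  rw [h1, h2, ← ENNReal.ofReal_mul hC]
  calc (ENNReal.ofReal (D * Real.pi ^ 2 * b) * ENNReal.ofReal (2 * D ^ 3 * Real.pi ^ 2 * b)) ^
        (1 / 2 : ℝ)
      ≤ (ENNReal.ofReal (C * b) * ENNReal.ofReal (C * b)) ^ (1 / 2 : ℝ) := by
        gcongr
        · exact le_add_of_nonneg_right (by positivity)
        · exact le_add_of_nonneg_left (by positivity)
    _ = ENNReal.ofReal (C * b) := by
        rw [← pow_two, ← ENNReal.rpow_natCast, ← ENNReal.rpow_mul]
        norm_num
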